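/- Let $X$ be a real-valued random variable on a probability space. Suppose that (1) $\mathbb{E}\,e^{b|X|^{a}}<\infty$ for some $b>0$ and some $a>1$, and (2) $\mathbb{E}\,e^{b'X^{2}}=\infty$ for every $b'>0$. Then $\mathbb{E}\,e^{zX}$ is well defined (that is, $e^{zX}$ is integrable) for every $z\in\mathbb{C}$, and the function $z\mapsto\mathbb{E}\,e^{zX}$ has a zero that is not purely imaginary: there is $z\in\mathbb{C}$ with $\operatorname{Re} z\neq 0$ and $\mathbb{E}\,e^{zX}=0$. -/

import Mathlib

open MeasureTheory ProbabilityTheory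

/-!
Suppose that `F z = E exp (z X)` has no zero off the imaginary axis. Then `F z * F (-z) = G (z ^ 2)`
for an entire function `G` of finite order with `G 0 = 1` whose zeros are all negative, and
`‖F z‖ ≤ F (re z)` turns into the ridge inequality `‖G (r e^{2iβ})‖ ≤ ‖G (r cos² β)‖`.

Write `log ‖G‖` as a canonical product of genus `N ≥ 2`. Moving the degree `N` terms of the first
`n` zeros into the exponential factor gives a coefficient of `w ^ N` that is monotone in `n`.
Letting `r → ∞`, the ridge inequality on a ray where the terms of degrees `m` and `m + 1` balance
(`m ∈ {N - 1, N}` even) and the bound `1 ≤ ‖G‖` on the positive axis bound its limit by `0` from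
the two sides. So the genus drops to `N - 1`; in genus `1`, `‖G r‖ ≤ e^{Ar}` for `r ≥ 0`.

Hence `F t * F (-t) ≤ e^{At²}` for real `t`, and since `F (-t) ≥ e^{-t E X}` by Jensen, the variable
`X - E X` is subgaussian. Averaging `E exp (g (X - E X))` over a centred Gaussian `g` of small
variance then shows that `E exp (b X²)` is finite for some `b > 0`.
-/

open Filter Topology Asymptotics

/-- The real part of the logarithm of the Weierstrass primary factor of genus `m` with zero `-1`,
at the point `x * exp (α * I)`. -/
noncomputable def primaryLog (m : ℕ) (α x : ℝ) : ℝ :=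
  Real.log (1 + 2 * x * Real.cos α + x ^ 2) / 2 +
    ∑ k ∈ Finset.Icc 1 m, (-1) ^ k * (x ^ k * Real.cos (k * α)) / k

theorem one_add_two_mul_cos_add_sq_pos {α x : ℝ} (hα : -1 < Real.cos α) (hx : 0 ≤ x) :
    0 < 1 + 2 * x * Real.cos α + x ^ 2 := by
  rcases hx.eq_or_lt with rfl | hx
  · norm_num
  · nlinarith [sq_nonneg (1 - x), mul_pos hx (by linarith : (0 : ℝ) < 1 + Real.cos α)]

theorem cos_nat_add_two_mul (m : ℕ) (α : ℝ) :
    Real.cos ((m + 2 : ℕ) * α) =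
      2 * Real.cos α * Real.cos ((m + 1 : ℕ) * α) - Real.cos (m * α) := by
  rw [show ((m + 2 : ℕ) : ℝ) * α = (m + 1 : ℕ) * α + α by push_cast; ring,
    show (m : ℝ) * α = (m + 1 : ℕ) * α - α by push_cast; ring, Real.cos_add, Real.cos_sub]
  ring

theorem primaryLog_succ (m : ℕ) (α x : ℝ) :
    primaryLog (m + 1) α x = primaryLog m α x +
      (-1) ^ (m + 1) * (x ^ (m + 1) * Real.cos ((m + 1 : ℕ) * α)) / (m + 1 : ℕ) := by
  rw [primaryLog, primaryLog, Finset.sum_Icc_succ_top (by lia)]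
  exact (add_assoc _ _ _).symm

theorem primaryLog_apply_zero (m : ℕ) (α : ℝ) : primaryLog m α 0 = 0 := by
  induction m with
  | zero => simp [primaryLog]
  | succ m ih => simp [primaryLog_succ, ih]

theorem hasDerivAt_primaryLog_zero {α x : ℝ} (hα : -1 < Real.cos α) (hx : 0 ≤ x) :
    HasDerivAt (primaryLog 0 α) ((Real.cos α + x) / (1 + 2 * x * Real.cos α + x ^ 2)) x := by
  have hquad : HasDerivAt (fun x => 1 + 2 * x * Real.cos α + x ^ 2) (2 * (Real.cos α + x)) x := by
    refine (((((hasDerivAt_id x).const_mul 2).mul_const (Real.cos α)).const_add 1).add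
      (hasDerivAt_pow 2 x)).congr_deriv ?_
    simp only [mul_one, Nat.cast_ofNat, Nat.add_one_sub_one, pow_one]
    ring
  have hpos := one_add_two_mul_cos_add_sq_pos hα hx
  have hlog : primaryLog 0 α = fun x => Real.log (1 + 2 * x * Real.cos α + x ^ 2) / 2 := by
    funext y
    simp [primaryLog]
  rw [hlog]
  refine ((hquad.log hpos.ne').div_const 2).congr_deriv ?_
  field_simp

theorem hasDerivAt_primaryLog (m : ℕ) {α x : ℝ} (hα : -1 < Real.cos α) (hx : 0 ≤ x) :
    HasDerivAt (primaryLog m α)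
      ((-1) ^ m * (x ^ m * (Real.cos ((m + 1 : ℕ) * α) + x * Real.cos (m * α))) /
        (1 + 2 * x * Real.cos α + x ^ 2)) x := by
  induction m with
  | zero => simpa using hasDerivAt_primaryLog_zero hα hx
  | succ m ih =>
    have hterm := (((hasDerivAt_pow (m + 1) x).mul_const (Real.cos ((m + 1 : ℕ) * α))).const_mul
      ((-1 : ℝ) ^ (m + 1))).div_const ((m + 1 : ℕ) : ℝ)
    rw [funext (primaryLog_succ m α)]
    refine (ih.add hterm).congr_deriv ?_
    rw [cos_nat_add_two_mul]
    have hpos := (one_add_two_mul_cos_add_sq_pos hα hx).ne'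
    have hm : ((m + 1 : ℕ) : ℝ) ≠ 0 := by positivity
    have hcancel : (-1 : ℝ) ^ (m + 1) * ((m + 1 : ℕ) * x ^ m * Real.cos ((m + 1 : ℕ) * α)) /
        (m + 1 : ℕ) = (-1) ^ (m + 1) * (x ^ m * Real.cos ((m + 1 : ℕ) * α)) := by
      field_simp
    rw [Nat.add_sub_cancel, hcancel, eq_div_iff hpos, add_mul, div_mul_cancel₀ _ hpos]
    ring

theorem hasDerivAt_primaryLog_angle_zero (m : ℕ) {x : ℝ} (hx : 0 ≤ x) :
    HasDerivAt (primaryLog m 0) ((-1) ^ m * (x ^ m / (1 + x))) x := by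
  refine (hasDerivAt_primaryLog m (by norm_num) hx).congr_deriv ?_
  have hx' : 1 + x ≠ 0 := by positivity
  simp only [mul_zero, Real.cos_zero, mul_one]
  rw [show 1 + 2 * x + x ^ 2 = (1 + x) ^ 2 by ring]
  field_simp

theorem le_of_hasDerivAt_le {f g f' g' : ℝ → ℝ} (hf : ∀ x, 0 ≤ x → HasDerivAt f (f' x) x)
    (hg : ∀ x, 0 ≤ x → HasDerivAt g (g' x) x) (h0 : f 0 ≤ g 0)
    (hle : ∀ x, 0 ≤ x → f' x ≤ g' x) {x : ℝ} (hx : 0 ≤ x) : f x ≤ g x := by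
  have hderiv : ∀ y, 0 ≤ y → HasDerivAt (g - f) (g' y - f' y) y :=
    fun y hy => (hg y hy).sub (hf y hy)
  have hmono : MonotoneOn (g - f) (Set.Ici 0) := by
    refine monotoneOn_of_hasDerivWithinAt_nonneg (f' := g' - f') (convex_Ici 0)
      (fun y hy => (hderiv y hy).continuousAt.continuousWithinAt) ?_ ?_ <;>
      rw [interior_Ici]
    · exact fun y hy => (hderiv y (le_of_lt hy)).hasDerivWithinAt
    · exact fun y hy => sub_nonneg.2 (hle y (le_of_lt hy))
  have := hmono Set.self_mem_Ici hx hx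
  simp only [Pi.sub_apply] at this
  linarith

theorem neg_one_pow_mul_primaryLog_nonneg (m : ℕ) {x : ℝ} (hx : 0 ≤ x) :
    0 ≤ (-1) ^ m * primaryLog m 0 x := by
  refine le_of_hasDerivAt_le (f := 0) (g := fun x => (-1) ^ m * primaryLog m 0 x) (f' := 0)
    (fun y _ => hasDerivAt_const y 0)
    (fun y hy => (hasDerivAt_primaryLog_angle_zero m hy).const_mul ((-1) ^ m))
    (by simp [primaryLog_apply_zero]) (fun y hy => ?_) hx
  rw [← mul_assoc, ← mul_pow, neg_one_mul, neg_neg, one_pow, one_mul]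
  exact div_nonneg (pow_nonneg hy m) (by positivity)

theorem primaryLog_nonneg {m : ℕ} (hm : Even m) {x : ℝ} (hx : 0 ≤ x) : 0 ≤ primaryLog m 0 x := by
  simpa [hm.neg_one_pow] using neg_one_pow_mul_primaryLog_nonneg m hx

theorem primaryLog_nonpos {m : ℕ} (hm : Odd m) {x : ℝ} (hx : 0 ≤ x) : primaryLog m 0 x ≤ 0 := by
  simpa [hm.neg_one_pow] using neg_one_pow_mul_primaryLog_nonneg m hx

theorem abs_primaryLog_le {m : ℕ} (hm : 1 ≤ m) {x : ℝ} (hx : 0 ≤ x) :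
    |primaryLog m 0 x| ≤ x ^ m / m := by
  obtain ⟨k, rfl⟩ := Nat.exists_eq_add_of_le' hm
  have hsucc := primaryLog_succ k 0 x
  rw [mul_zero, Real.cos_zero, mul_one] at hsucc
  rcases Nat.even_or_odd k with hk | hk
  · rw [hk.add_one.neg_one_pow, neg_one_mul, neg_div] at hsucc
    rw [abs_of_nonpos (primaryLog_nonpos hk.add_one hx)]
    linarith [primaryLog_nonneg hk hx]
  · rw [hk.add_one.neg_one_pow, one_mul] at hsucc
    rw [abs_of_nonneg (primaryLog_nonneg hk.add_one hx)]
    linarith [primaryLog_nonpos hk hx]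

theorem primaryLog_isLittleO {m : ℕ} (hm : 1 ≤ m) :
    primaryLog m 0 =o[atTop] fun x => x ^ (m + 1) := by
  have hbigO : primaryLog m 0 =O[atTop] fun x => x ^ m := by
    refine IsBigO.of_bound (1 / m) ?_
    filter_upwards [eventually_ge_atTop 0] with x hx
    rw [Real.norm_eq_abs, Real.norm_of_nonneg (pow_nonneg hx m), one_div_mul_eq_div]
    exact abs_primaryLog_le hm hx
  exact hbigO.trans_isLittleO (isLittleO_pow_pow_atTop_of_lt m.lt_succ_self)

theorem primaryLog_mul_le {m : ℕ} (hm : Even m) {q x : ℝ} (hq0 : 0 ≤ q) (hq1 : q ≤ 1)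
    (hx : 0 ≤ x) : primaryLog m 0 (x * q) ≤ q ^ m * primaryLog m 0 x := by
  refine le_of_hasDerivAt_le (f := fun x => primaryLog m 0 (x * q))
    (g := fun x => q ^ m * primaryLog m 0 x)
    (fun y hy => HasDerivAt.comp (h := fun x => x * q) y
      (hasDerivAt_primaryLog_angle_zero m (mul_nonneg hy hq0)) (hasDerivAt_mul_const q))
    (fun y hy => (hasDerivAt_primaryLog_angle_zero m hy).const_mul (q ^ m))
    (by simp [primaryLog_apply_zero]) (fun y hy => ?_) hx
  have hfrac : q / (1 + y * q) ≤ 1 / (1 + y) := by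
    rw [div_le_div_iff₀ (by positivity) (by positivity)]
    nlinarith
  rw [hm.neg_one_pow, one_mul, one_mul]
  calc (y * q) ^ m / (1 + y * q) * q = (y * q) ^ m * (q / (1 + y * q)) := by ring
    _ ≤ (y * q) ^ m * (1 / (1 + y)) := by gcongr
    _ = q ^ m * (y ^ m / (1 + y)) := by ring

/-- The half-angle `β` for which the terms of degrees `m` and `m + 1` take the same value on the
ray of argument `2 * β`: their cosines `cos (m * 2β)` and `cos ((m + 1) * 2β)` both equal
`cos β`. -/
noncomputable def balancedAngle (m : ℕ) : ℝ := 2 * Real.pi / (2 * m + 1)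

theorem balancedAngle_pos (m : ℕ) : 0 < balancedAngle m := by
  unfold balancedAngle
  positivity

theorem balancedAngle_lt {m : ℕ} (hm : 2 ≤ m) : balancedAngle m < Real.pi / 2 := by
  have hm' : (2 : ℝ) ≤ m := by exact_mod_cast hm
  rw [balancedAngle, div_lt_div_iff₀ (by positivity) (by positivity)]
  nlinarith [Real.pi_pos]

theorem cos_balancedAngle_pos {m : ℕ} (hm : 2 ≤ m) : 0 < Real.cos (balancedAngle m) :=
  Real.cos_pos_of_mem_Ioo ⟨by linarith [balancedAngle_pos m, Real.pi_pos], balancedAngle_lt hm⟩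

theorem cos_balancedAngle_lt_one {m : ℕ} (hm : 2 ≤ m) : Real.cos (balancedAngle m) < 1 := by
  rw [← Real.cos_zero]
  exact Real.cos_lt_cos_of_nonneg_of_le_pi le_rfl
    (by linarith [balancedAngle_lt hm, Real.pi_pos]) (balancedAngle_pos m)

theorem cos_mul_two_balancedAngle (m : ℕ) :
    Real.cos (m * (2 * balancedAngle m)) = Real.cos (balancedAngle m) := by
  have hangle : (m : ℝ) * (2 * balancedAngle m) = 2 * Real.pi - balancedAngle m := by
    unfold balancedAngle
    field_simp
    ring
  rw [hangle, Real.cos_two_pi_sub]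

theorem cos_succ_mul_two_balancedAngle (m : ℕ) :
    Real.cos ((m + 1 : ℕ) * (2 * balancedAngle m)) = Real.cos (balancedAngle m) := by
  have hangle : ((m + 1 : ℕ) : ℝ) * (2 * balancedAngle m) = balancedAngle m + 2 * Real.pi := by
    unfold balancedAngle
    push_cast
    field_simp
    ring
  rw [hangle, Real.cos_add_two_pi]

theorem neg_one_lt_cos_two_mul_balancedAngle {m : ℕ} (hm : 2 ≤ m) :
    -1 < Real.cos (2 * balancedAngle m) := by
  rw [Real.cos_two_mul]
  nlinarith [cos_balancedAngle_pos hm]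

theorem sq_cos_balancedAngle_pow_lt {m k : ℕ} (hm : 2 ≤ m) (hk : 1 ≤ k) :
    (Real.cos (balancedAngle m) ^ 2) ^ k < Real.cos (balancedAngle m) := by
  rw [← pow_mul]
  exact pow_lt_self_of_lt_one₀ (cos_balancedAngle_pos hm) (cos_balancedAngle_lt_one hm) (by lia)

theorem cos_mul_primaryLog_le_primaryLog_balancedAngle {m : ℕ} (hm : Even m) (h2 : 2 ≤ m) {x : ℝ}
    (hx : 0 ≤ x) :
    Real.cos (balancedAngle m) * primaryLog m 0 x ≤ primaryLog m (2 * balancedAngle m) x := by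
  have hα := neg_one_lt_cos_two_mul_balancedAngle h2
  have hc := cos_balancedAngle_pos h2
  refine le_of_hasDerivAt_le
    (fun y hy => (hasDerivAt_primaryLog_angle_zero m hy).const_mul (Real.cos (balancedAngle m)))
    (fun y hy => hasDerivAt_primaryLog m hα hy) (by simp [primaryLog_apply_zero])
    (fun y hy => ?_) hx
  have hpos := one_add_two_mul_cos_add_sq_pos hα hy
  have hfrac : 1 / (1 + y) ≤ (1 + y) / (1 + 2 * y * Real.cos (2 * balancedAngle m) + y ^ 2) := by
    rw [div_le_div_iff₀ (by positivity) hpos]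
    nlinarith [Real.cos_le_one (2 * balancedAngle m)]
  rw [cos_mul_two_balancedAngle, cos_succ_mul_two_balancedAngle, hm.neg_one_pow, one_mul, one_mul]
  calc Real.cos (balancedAngle m) * (y ^ m / (1 + y)) =
        Real.cos (balancedAngle m) * y ^ m * (1 / (1 + y)) := by ring
    _ ≤ Real.cos (balancedAngle m) * y ^ m *
        ((1 + y) / (1 + 2 * y * Real.cos (2 * balancedAngle m) + y ^ 2)) := by gcongr
    _ = _ := by ring

theorem primaryLog_mul_sub_primaryLog_balancedAngle_le {m : ℕ} (hm : Even m) (h2 : 2 ≤ m) {x : ℝ}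
    (hx : 0 ≤ x) :
    primaryLog m 0 (x * Real.cos (balancedAngle m) ^ 2) - primaryLog m (2 * balancedAngle m) x ≤
      ((Real.cos (balancedAngle m) ^ 2) ^ m - Real.cos (balancedAngle m)) * primaryLog m 0 x := by
  have hray := cos_mul_primaryLog_le_primaryLog_balancedAngle hm h2 hx
  have haxis := primaryLog_mul_le hm (sq_nonneg (Real.cos (balancedAngle m)))
    (Real.cos_sq_le_one _) hx
  linarith

theorem nonneg_of_isLittleO {ι : Type*} {l : Filter ι} [l.NeBot] {f g : ι → ℝ} {a : ℝ}
    (hg : ∀ᶠ x in l, 0 < g x) (hf : f =o[l] g) (h : ∀ᶠ x in l, 0 ≤ a * g x + f x) : 0 ≤ a := by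
  by_contra! ha
  obtain ⟨x, hgx, hfx, hx⟩ := (hg.and ((hf.def (half_pos (neg_pos.2 ha))).and h)).exists
  rw [Real.norm_eq_abs, Real.norm_of_nonneg hgx.le] at hfx
  nlinarith [le_abs_self (f x), mul_pos (neg_pos.2 ha) hgx]

theorem sum_mul_pow_isLittleO (c : ℕ → ℝ) (N : ℕ) :
    (fun r => ∑ k ∈ Finset.Icc 1 N, c k * r ^ k) =o[atTop] fun r : ℝ => r ^ (N + 1) :=
  IsLittleO.fun_sum fun _ hk => (isLittleO_pow_pow_atTop_of_lt
    (Nat.lt_succ_of_le (Finset.mem_Icc.1 hk).2)).const_mul_left _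

/-- The real part, at `r * exp (α * I)`, of the logarithm of a finite canonical product of genus `N`
with zeros `-s`, `s ∈ Z`, of multiplicity `ν s`, and with exponential factor `∑ p k * w ^ k`. -/
noncomputable def genusSum (Z : Finset ℝ) (ν : ℝ → ℕ) (p : ℕ → ℝ) (N : ℕ) (r α : ℝ) : ℝ :=
  ∑ k ∈ Finset.Icc 1 N, p k * (r ^ k * Real.cos (k * α)) +
    ∑ s ∈ Z, ν s * primaryLog N α (r / s)

/-- The coefficient of degree `k` in the exponential factor of a canonical product that has been
rewritten with primary factors of genus less than `k`. -/
noncomputable def genusCoeff (Z : Finset ℝ) (ν : ℝ → ℕ) (p : ℕ → ℝ) (k : ℕ) : ℝ :=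
  p k + (-1) ^ k / k * ∑ s ∈ Z, ν s / s ^ k

section GenusSum

variable (Z : Finset ℝ) (ν : ℝ → ℕ) (p : ℕ → ℝ)

theorem genusCoeff_mul_pow (k : ℕ) (r : ℝ) :
    genusCoeff Z ν p k * r ^ k = p k * r ^ k + ∑ s ∈ Z, ν s * ((-1) ^ k * (r / s) ^ k / k) := by
  rw [genusCoeff, add_mul, Finset.mul_sum, Finset.sum_mul]
  congr 1
  exact Finset.sum_congr rfl fun s _ => by rw [div_pow]; ring

theorem sum_mul_primaryLog_succ (N : ℕ) (r α : ℝ) :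
    p (N + 1) * r ^ (N + 1) * Real.cos ((N + 1 : ℕ) * α) +
        ∑ s ∈ Z, ν s * primaryLog (N + 1) α (r / s) =
      genusCoeff Z ν p (N + 1) * r ^ (N + 1) * Real.cos ((N + 1 : ℕ) * α) +
        ∑ s ∈ Z, ν s * primaryLog N α (r / s) := by
  simp only [genusCoeff_mul_pow, primaryLog_succ, mul_add, Finset.sum_add_distrib, add_mul,
    Finset.sum_mul]
  rw [add_assoc, add_comm (∑ s ∈ Z, _ * primaryLog N α _)]
  congr 2
  exact Finset.sum_congr rfl fun s _ => by ring

theorem genusSum_succ (N : ℕ) (r α : ℝ) :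
    genusSum Z ν p (N + 1) r α = genusSum Z ν p N r α +
      genusCoeff Z ν p (N + 1) * r ^ (N + 1) * Real.cos ((N + 1 : ℕ) * α) := by
  have hsucc := sum_mul_primaryLog_succ Z ν p N r α
  rw [genusSum, genusSum, Finset.sum_Icc_succ_top (by lia)]
  linarith

theorem genusSum_angle_zero (N : ℕ) (r : ℝ) :
    genusSum Z ν p N r 0 =
      ∑ k ∈ Finset.Icc 1 N, p k * 1 * r ^ k + ∑ s ∈ Z, ν s * primaryLog N 0 (r / s) := by
  simp [genusSum]

theorem genusSum_mul_sub_genusSum (N : ℕ) (r q α : ℝ) :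
    genusSum Z ν p N (r * q) 0 - genusSum Z ν p N r α =
      ∑ k ∈ Finset.Icc 1 N, p k * (q ^ k - Real.cos (k * α)) * r ^ k +
        ∑ s ∈ Z, ν s * (primaryLog N 0 (r / s * q) - primaryLog N α (r / s)) := by
  simp only [genusSum, mul_sub, sub_mul, Finset.sum_sub_distrib, mul_zero, Real.cos_zero, mul_one,
    mul_pow, div_mul_eq_mul_div]
  rw [add_sub_add_comm]
  congr 2 <;> exact Finset.sum_congr rfl fun k _ => by ring

end GenusSum

/-- The function `U` of `(r, α)` is the limit of the finite canonical products `genusSum` of genus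
`N` over the exhausting zero sets `Z n`, on every ray other than the negative axis. -/
def HasGenusRep (Z : ℕ → Finset ℝ) (ν : ℝ → ℕ) (p : ℕ → ℝ) (N : ℕ) (U : ℝ → ℝ → ℝ) : Prop :=
  ∀ ⦃r⦄, 0 ≤ r → ∀ ⦃α⦄, -1 < Real.cos α →
    Tendsto (fun n => genusSum (Z n) ν p N r α) atTop (𝓝 (U r α))

/-- The ridge property for a function given in polar coordinates. The point `r * exp (2 * β * I)` is
the square of `√r * exp (β * I)`, whose real part has square `r * cos β ^ 2`; so this is what
becomes of `‖f z‖ ≤ ‖f z.re‖` for `U (z ^ 2) = log ‖f z * f (-z)‖`. -/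
structure IsRidge (U : ℝ → ℝ → ℝ) : Prop where
  nonneg : ∀ ⦃r⦄, 0 ≤ r → 0 ≤ U r 0
  le : ∀ ⦃r β⦄, 0 ≤ r → -1 < Real.cos (2 * β) → U r (2 * β) ≤ U (r * Real.cos β ^ 2) 0

section Descent

variable {Z : ℕ → Finset ℝ} {ν : ℝ → ℕ} {p : ℕ → ℝ} {U : ℝ → ℝ → ℝ} {N : ℕ}

theorem monotone_sum_mul (hZ : Monotone Z) (hpos : ∀ n, ∀ s ∈ Z n, 0 < s) {g : ℝ → ℝ}
    (hg : ∀ s, 0 < s → 0 ≤ g s) : Monotone fun n => ∑ s ∈ Z n, ν s * g s :=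
  fun _ b hab => Finset.sum_le_sum_of_subset_of_nonneg (hZ hab) fun s hs _ =>
    mul_nonneg (ν s).cast_nonneg (hg s (hpos b s hs))

theorem monotone_neg_one_pow_mul_genusCoeff (hZ : Monotone Z) (hpos : ∀ n, ∀ s ∈ Z n, 0 < s)
    (k : ℕ) : Monotone fun n => (-1) ^ k * genusCoeff (Z n) ν p k := by
  intro a b hab
  have hsum := monotone_sum_mul (ν := ν) hZ hpos (g := fun s => 1 / s ^ k)
    (fun s hs => by positivity) hab
  have hsign : (-1 : ℝ) ^ k * (-1) ^ k = 1 := by rw [← mul_pow, neg_one_mul, neg_neg, one_pow]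
  simp only [mul_one_div] at hsum
  simp only [genusCoeff, mul_add, ← mul_assoc, ← mul_div_assoc, hsign]
  gcongr

theorem monotone_genusCoeff (hZ : Monotone Z) (hpos : ∀ n, ∀ s ∈ Z n, 0 < s) {k : ℕ}
    (hk : Even k) : Monotone fun n => genusCoeff (Z n) ν p k := by
  simpa [hk.neg_one_pow] using monotone_neg_one_pow_mul_genusCoeff (ν := ν) (p := p) hZ hpos k

theorem antitone_genusCoeff (hZ : Monotone Z) (hpos : ∀ n, ∀ s ∈ Z n, 0 < s) {k : ℕ}
    (hk : Odd k) : Antitone fun n => genusCoeff (Z n) ν p k := by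
  simpa [hk.neg_one_pow] using
    (monotone_neg_one_pow_mul_genusCoeff (ν := ν) (p := p) hZ hpos k).neg

theorem sum_mul_primaryLog_isLittleO {Z : Finset ℝ} (hpos : ∀ s ∈ Z, 0 < s) (hN : 1 ≤ N) :
    (fun r => ∑ s ∈ Z, ν s * primaryLog N 0 (r / s)) =o[atTop] fun r : ℝ => r ^ (N + 1) := by
  refine IsLittleO.fun_sum fun s hs => IsLittleO.const_mul_left ?_ _
  refine ((primaryLog_isLittleO hN).comp_tendsto
    (tendsto_id.atTop_div_const (hpos s hs))).trans_isBigO ?_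
  simp only [Function.comp_def, id_eq, div_eq_inv_mul, mul_pow]
  exact (isBigO_refl (fun r : ℝ => r ^ (N + 1)) atTop).const_mul_left _

/-- As `r → ∞`, the term of degree `N + 1` left over once finitely many factors are rewritten in
genus `N` dominates everything else except the remaining factors, which have a sign. -/
theorem mul_genusCoeff_nonneg (hZ : Monotone Z) (hpos : ∀ n, ∀ s ∈ Z n, 0 < s) (hN : 1 ≤ N)
    {c : ℕ → ℝ} {e : ℝ → ℝ} {u : ℝ → ℝ}
    (hlim : ∀ r, 0 ≤ r → Tendsto (fun n => ∑ k ∈ Finset.Icc 1 (N + 1), p k * c k * r ^ k +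
      ∑ s ∈ Z n, ν s * e (r / s)) atTop (𝓝 (u r)))
    (hu : ∀ r, 0 ≤ r → 0 ≤ u r)
    (he : ∀ x, 0 ≤ x → e x ≤ c (N + 1) * primaryLog (N + 1) 0 x)
    (hneg : ∀ x, 0 ≤ x → c (N + 1) * primaryLog (N + 1) 0 x ≤ 0) (n : ℕ) :
    0 ≤ c (N + 1) * genusCoeff (Z n) ν p (N + 1) := by
  refine nonneg_of_isLittleO (g := fun r => r ^ (N + 1))
    (f := fun r => ∑ k ∈ Finset.Icc 1 N, p k * c k * r ^ k +
      c (N + 1) * ∑ s ∈ Z n, ν s * primaryLog N 0 (r / s))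
    ((eventually_gt_atTop 0).mono fun r hr => pow_pos hr _)
    ((sum_mul_pow_isLittleO (fun k => p k * c k) N).add
      ((sum_mul_primaryLog_isLittleO (hpos n) hN).const_mul_left _)) ?_
  filter_upwards [eventually_ge_atTop 0] with r hr
  refine (hu r hr).trans (le_of_tendsto (hlim r hr) ?_)
  filter_upwards [eventually_ge_atTop n] with m hm
  have hsum : ∑ s ∈ Z m, ν s * e (r / s) ≤
      c (N + 1) * ∑ s ∈ Z n, ν s * primaryLog (N + 1) 0 (r / s) := by
    have hmono := monotone_sum_mul (ν := ν) hZ hpos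
      (g := fun s => -(c (N + 1) * primaryLog (N + 1) 0 (r / s)))
      (fun s hs => neg_nonneg.2 (hneg _ (div_nonneg hr hs.le))) hm
    simp only [mul_neg, Finset.sum_neg_distrib, neg_le_neg_iff] at hmono
    calc ∑ s ∈ Z m, ν s * e (r / s)
        ≤ ∑ s ∈ Z m, ν s * (c (N + 1) * primaryLog (N + 1) 0 (r / s)) := by
          gcongr with s hs
          exact he _ (div_nonneg hr (hpos m s hs).le)
      _ ≤ ∑ s ∈ Z n, ν s * (c (N + 1) * primaryLog (N + 1) 0 (r / s)) := hmono
      _ = _ := by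
          rw [Finset.mul_sum]
          exact Finset.sum_congr rfl fun s _ => by ring
  have hsucc := sum_mul_primaryLog_succ (Z n) ν p N r 0
  simp only [mul_zero, Real.cos_zero, mul_one] at hsucc
  rw [Finset.sum_Icc_succ_top (by lia)]
  linear_combination hsum + c (N + 1) * hsucc

theorem nonneg_of_mul_genusCoeff_le (hpos : ∀ n, ∀ s ∈ Z n, 0 < s)
    {c : ℕ → ℝ} {e : ℝ → ℝ} {u : ℝ → ℝ} {b : ℝ}
    (hlim : ∀ r, 0 ≤ r → Tendsto (fun n => ∑ k ∈ Finset.Icc 1 (N + 1), p k * c k * r ^ k +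
      ∑ s ∈ Z n, ν s * e (r / s)) atTop (𝓝 (u r)))
    (hu : ∀ r, 0 ≤ r → 0 ≤ u r)
    (he : ∀ x, 0 ≤ x → e x ≤ c (N + 1) * ((-1) ^ (N + 1) * x ^ (N + 1) / (N + 1 : ℕ)))
    (hb : ∀ n, c (N + 1) * genusCoeff (Z n) ν p (N + 1) ≤ b) : 0 ≤ b := by
  refine nonneg_of_isLittleO ((eventually_gt_atTop 0).mono fun r hr => pow_pos hr (N + 1))
    (sum_mul_pow_isLittleO (fun k => p k * c k) N) ?_
  filter_upwards [eventually_ge_atTop 0] with r hr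
  refine (hu r hr).trans (le_of_tendsto' (hlim r hr) fun n => ?_)
  have hsum : ∑ s ∈ Z n, ν s * e (r / s) ≤ c (N + 1) *
      ∑ s ∈ Z n, ν s * ((-1) ^ (N + 1) * (r / s) ^ (N + 1) / (N + 1 : ℕ)) := by
    rw [Finset.mul_sum]
    refine Finset.sum_le_sum fun s hs => ?_
    rw [mul_left_comm]
    exact mul_le_mul_of_nonneg_left (he _ (div_nonneg hr (hpos n s hs).le)) (ν s).cast_nonneg
  have hcoeff := mul_le_mul_of_nonneg_right (hb n) (pow_nonneg hr (N + 1))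
  rw [mul_assoc, genusCoeff_mul_pow, mul_add] at hcoeff
  rw [Finset.sum_Icc_succ_top (by lia)]
  linarith

theorem HasGenusRep.tendsto_axis (h : HasGenusRep Z ν p N U) {r : ℝ} (hr : 0 ≤ r) :
    Tendsto (fun n => ∑ k ∈ Finset.Icc 1 N, p k * 1 * r ^ k +
      ∑ s ∈ Z n, ν s * primaryLog N 0 (r / s)) atTop (𝓝 (U r 0)) :=
  (h hr (by norm_num)).congr fun n => genusSum_angle_zero (Z n) ν p N r

theorem HasGenusRep.tendsto_ridge_gap (h : HasGenusRep Z ν p N U) {β : ℝ}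
    (hβ : -1 < Real.cos (2 * β)) {r : ℝ} (hr : 0 ≤ r) :
    Tendsto (fun n =>
      ∑ k ∈ Finset.Icc 1 N, p k * ((Real.cos β ^ 2) ^ k - Real.cos (k * (2 * β))) * r ^ k +
        ∑ s ∈ Z n, ν s * (primaryLog N 0 (r / s * Real.cos β ^ 2) - primaryLog N (2 * β) (r / s)))
      atTop (𝓝 (U (r * Real.cos β ^ 2) 0 - U r (2 * β))) :=
  ((h (mul_nonneg hr (sq_nonneg _)) (by norm_num)).sub (h hr hβ)).congr
    fun n => genusSum_mul_sub_genusSum (Z n) ν p N r (Real.cos β ^ 2) (2 * β)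

theorem tendsto_genusCoeff_of_even (hZ : Monotone Z) (hpos : ∀ n, ∀ s ∈ Z n, 0 < s)
    (hU : IsRidge U) (hrep : HasGenusRep Z ν p (N + 1) U) (hN : Even (N + 1)) :
    Tendsto (fun n => genusCoeff (Z n) ν p (N + 1)) atTop (𝓝 0) := by
  have hN' : Odd N := by grind
  have h2 : 2 ≤ N + 1 := by linarith [hN'.pos]
  set β := balancedAngle (N + 1)
  have hβ : -1 < Real.cos (2 * β) := neg_one_lt_cos_two_mul_balancedAngle h2
  have hU_gap : ∀ r, 0 ≤ r → 0 ≤ U (r * Real.cos β ^ 2) 0 - U r (2 * β) :=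
    fun r hr => sub_nonneg.2 (hU.le hr hβ)
  have hgap : (Real.cos β ^ 2) ^ (N + 1) - Real.cos β < 0 :=
    sub_neg.2 (sq_cos_balancedAngle_pow_lt h2 (by lia))
  have hcos : Real.cos ((N + 1 : ℕ) * (2 * β)) = Real.cos β := cos_mul_two_balancedAngle (N + 1)
  have hnonpos : ∀ n, genusCoeff (Z n) ν p (N + 1) ≤ 0 := fun n => by
    refine nonpos_of_mul_nonneg_right (mul_genusCoeff_nonneg hZ hpos hN'.pos
      (c := fun k => (Real.cos β ^ 2) ^ k - Real.cos (k * (2 * β)))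
      (e := fun x => primaryLog (N + 1) 0 (x * Real.cos β ^ 2) - primaryLog (N + 1) (2 * β) x)
      (fun r hr => hrep.tendsto_ridge_gap hβ hr)
      hU_gap (fun x hx => ?_) (fun x hx => ?_) n) ?_
    · rw [hcos]
      exact primaryLog_mul_sub_primaryLog_balancedAngle_le hN h2 hx
    · rw [hcos]
      exact mul_nonpos_of_nonpos_of_nonneg hgap.le (primaryLog_nonneg hN hx)
    · rwa [hcos]
  refine tendsto_atTop_isLUB (monotone_genusCoeff hZ hpos hN)
    ⟨Set.forall_mem_range.2 hnonpos, fun b hb => ?_⟩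
  refine nonneg_of_mul_genusCoeff_le hpos (c := fun _ => 1)
    (fun r hr => hrep.tendsto_axis hr) (fun r hr => hU.nonneg hr) (fun x hx => ?_)
    (fun n => by simpa using hb (Set.mem_range_self n))
  rw [primaryLog_succ, mul_zero, Real.cos_zero, mul_one, one_mul]
  exact add_le_of_nonpos_left (primaryLog_nonpos hN' hx)

theorem tendsto_genusCoeff_of_odd (hZ : Monotone Z) (hpos : ∀ n, ∀ s ∈ Z n, 0 < s)
    (hU : IsRidge U) (hrep : HasGenusRep Z ν p (N + 1) U) (hN : Odd (N + 1)) (h2 : 2 ≤ N) :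
    Tendsto (fun n => genusCoeff (Z n) ν p (N + 1)) atTop (𝓝 0) := by
  have hN' : Even N := by grind
  set β := balancedAngle N
  have hβ : -1 < Real.cos (2 * β) := neg_one_lt_cos_two_mul_balancedAngle h2
  have hU_gap : ∀ r, 0 ≤ r → 0 ≤ U (r * Real.cos β ^ 2) 0 - U r (2 * β) :=
    fun r hr => sub_nonneg.2 (hU.le hr hβ)
  have hgap : ∀ k, 1 ≤ k → (Real.cos β ^ 2) ^ k - Real.cos β < 0 :=
    fun k hk => sub_neg.2 (sq_cos_balancedAngle_pow_lt h2 hk)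
  have hcos : Real.cos ((N + 1 : ℕ) * (2 * β)) = Real.cos β := cos_succ_mul_two_balancedAngle N
  have hnonneg : ∀ n, 0 ≤ genusCoeff (Z n) ν p (N + 1) := fun n => by
    simpa using mul_genusCoeff_nonneg hZ hpos (by lia) (c := fun _ => 1)
      (fun r hr => hrep.tendsto_axis hr)
      (fun r hr => hU.nonneg hr) (fun x _ => (one_mul _).ge)
      (fun x hx => (one_mul _).trans_le (primaryLog_nonpos hN hx)) n
  refine tendsto_atTop_isGLB (antitone_genusCoeff hZ hpos hN)
    ⟨Set.forall_mem_range.2 hnonneg, fun b hb => ?_⟩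
  refine nonpos_of_mul_nonneg_right (nonneg_of_mul_genusCoeff_le hpos
    (c := fun k => (Real.cos β ^ 2) ^ k - Real.cos (k * (2 * β)))
    (e := fun x => primaryLog (N + 1) 0 (x * Real.cos β ^ 2) - primaryLog (N + 1) (2 * β) x)
    (fun r hr => hrep.tendsto_ridge_gap hβ hr) hU_gap (fun x hx => ?_) (fun n => ?_))
    (hgap (N + 1) (by lia))
  · have hnonpos := (primaryLog_mul_sub_primaryLog_balancedAngle_le hN' h2 hx).trans
      (mul_nonpos_of_nonpos_of_nonneg (hgap N (by lia)).le (primaryLog_nonneg hN' hx))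
    rw [primaryLog_succ, primaryLog_succ, mul_zero, Real.cos_zero, mul_pow x]
    linear_combination hnonpos
  · rw [hcos]
    exact mul_le_mul_of_nonpos_left (hb (Set.mem_range_self n)) (hgap (N + 1) (by lia)).le

theorem HasGenusRep.of_succ (hZ : Monotone Z) (hpos : ∀ n, ∀ s ∈ Z n, 0 < s) (hU : IsRidge U)
    (hN : 1 ≤ N) (hrep : HasGenusRep Z ν p (N + 1) U) : HasGenusRep Z ν p N U := by
  intro r hr α hα
  have hcoeff : Tendsto (fun n => genusCoeff (Z n) ν p (N + 1)) atTop (𝓝 0) := by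
    rcases Nat.even_or_odd (N + 1) with h | h
    · exact tendsto_genusCoeff_of_even hZ hpos hU hrep h
    · exact tendsto_genusCoeff_of_odd hZ hpos hU hrep h (by grind)
  have hlim := (hrep hr hα).sub
    ((hcoeff.mul_const (r ^ (N + 1))).mul_const (Real.cos ((N + 1 : ℕ) * α)))
  rw [zero_mul, zero_mul, sub_zero] at hlim
  exact hlim.congr fun n => by rw [genusSum_succ, add_sub_cancel_right]

theorem HasGenusRep.le_mul (hZ : Monotone Z) (hpos : ∀ n, ∀ s ∈ Z n, 0 < s) (hU : IsRidge U)
    (hN : 1 ≤ N) (hrep : HasGenusRep Z ν p N U) {r : ℝ} (hr : 0 ≤ r) : U r 0 ≤ p 1 * r := by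
  have hrep_one : HasGenusRep Z ν p 1 U := by
    induction N, hN using Nat.le_induction with
    | base => exact hrep
    | succ N hN ih => exact ih (hrep.of_succ hZ hpos hU hN)
  refine le_of_tendsto' (hrep_one hr (by norm_num : -1 < Real.cos 0)) fun n => ?_
  have hsum : ∑ s ∈ Z n, ν s * primaryLog 1 0 (r / s) ≤ 0 :=
    Finset.sum_nonpos fun s hs => mul_nonpos_of_nonneg_of_nonpos (ν s).cast_nonneg
      (primaryLog_nonpos odd_one (div_nonneg hr (hpos n s hs).le))
  simpa [genusSum] using hsum

end Descent

theorem differentiable_iterate_dslope {f : ℂ → ℂ} (hf : Differentiable ℂ f) (a : ℂ) (n : ℕ) :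
    Differentiable ℂ ((Function.swap dslope a)^[n] f) := by
  induction n with
  | zero => exact hf
  | succ n ih =>
    rw [Function.iterate_succ_apply']
    exact differentiableOn_univ.1 ((Complex.differentiableOn_dslope univ_mem).2 ih.differentiableOn)

theorem exists_eq_pow_mul_of_differentiable {f : ℂ → ℂ} (hf : Differentiable ℂ f)
    (hne : ∃ w, f w ≠ 0) (a : ℂ) :
    ∃ g : ℂ → ℂ, Differentiable ℂ g ∧ g a ≠ 0 ∧
      ∀ w, f w = (w - a) ^ analyticOrderNatAt f a * g w := by
  obtain ⟨q, hq⟩ := hf.analyticAt a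
  have hq0 : q ≠ 0 := by
    rintro rfl
    obtain ⟨w, hw⟩ := hne
    have hzero := AnalyticOnNhd.eq_of_eventuallyEq (f := f) (g := 0) (fun z _ => hf.analyticAt z)
      (fun z _ => analyticAt_const) (hq.locally_zero_iff.2 rfl)
    exact hw (congrFun hzero w)
  have hd := differentiable_iterate_dslope hf a q.order
  have hda := hq.iterate_dslope_fslope_ne_zero hq0
  have hfactor := hq.eq_pow_order_mul_iterate_dslope
  have horder : analyticOrderAt f a = q.order :=
    (hf.analyticAt a).analyticOrderAt_eq_natCast.2
      ⟨_, hd.analyticAt a, hda, Eventually.of_forall hfactor⟩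
  refine ⟨_, hd, hda, fun w => ?_⟩
  rw [analyticOrderNatAt, horder, ENat.toNat_natCast]
  exact hfactor w

theorem analyticOrderNatAt_mul_of_left_ne_zero {f g : ℂ → ℂ} {a : ℂ} (hf : AnalyticAt ℂ f a)
    (hg : AnalyticAt ℂ g a) (hfa : f a ≠ 0) :
    analyticOrderNatAt (fun w => f w * g w) a = analyticOrderNatAt g a := by
  have horder := analyticOrderAt_mul hf hg
  rw [hf.analyticOrderAt_eq_zero.2 hfa, zero_add] at horder
  exact congrArg ENat.toNat horder

theorem exists_eq_prod_mul_of_differentiable {f : ℂ → ℂ} (hf : Differentiable ℂ f)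
    (hne : ∃ w, f w ≠ 0) (S : Finset ℂ) :
    ∃ g : ℂ → ℂ, Differentiable ℂ g ∧ (∀ a ∈ S, g a ≠ 0) ∧
      ∀ w, f w = (∏ a ∈ S, (w - a) ^ analyticOrderNatAt f a) * g w := by
  induction S using Finset.induction_on with
  | empty => exact ⟨f, hf, by simp, by simp⟩
  | insert b S hb ih =>
    obtain ⟨g, hg, hgS, hfg⟩ := ih
    obtain ⟨k, hk, hkb, hgk⟩ := exists_eq_pow_mul_of_differentiable hg
      (hne.imp fun w hw hgw => hw (by rw [hfg, hgw, mul_zero])) b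
    have hprod : Differentiable ℂ fun w => ∏ a ∈ S, (w - a) ^ analyticOrderNatAt f a := by fun_prop
    have hprod_ne : ∏ a ∈ S, (b - a) ^ analyticOrderNatAt f a ≠ 0 :=
      Finset.prod_ne_zero_iff.2 fun a ha =>
        pow_ne_zero _ (sub_ne_zero.2 (ne_of_mem_of_not_mem ha hb).symm)
    have horder : analyticOrderNatAt f b = analyticOrderNatAt g b := by
      conv_lhs => rw [funext hfg]
      exact analyticOrderNatAt_mul_of_left_ne_zero (hprod.analyticAt b) (hg.analyticAt b) hprod_ne
    refine ⟨k, hk, ?_, fun w => ?_⟩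
    · rw [Finset.forall_mem_insert]
      exact ⟨hkb, fun a ha hka => hgS a ha (by rw [hgk, hka, mul_zero])⟩
    · rw [Finset.prod_insert hb, horder, hfg, hgk]
      ring

theorem exists_exp_eq_on_ball {g : ℂ → ℂ} {c : ℂ} {R : ℝ}
    (hg : DifferentiableOn ℂ g (Metric.ball c R)) (hR : 0 < R) (hgc : g c = 1)
    (hne : ∀ w ∈ Metric.ball c R, g w ≠ 0) :
    ∃ h : ℂ → ℂ, DifferentiableOn ℂ h (Metric.ball c R) ∧ h c = 0 ∧
      ∀ w ∈ Metric.ball c R, Complex.exp (h w) = g w := by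
  obtain ⟨h, hhc, hh⟩ :=
    ((hg.deriv Metric.isOpen_ball).div hg hne).isExactOn_ball.with_val_at c 0
  have hderiv : ∀ z ∈ Metric.ball c R, HasDerivAt (fun w => g w * Complex.exp (-h w)) 0 z := by
    intro z hz
    have hgz := (hg.differentiableAt (Metric.isOpen_ball.mem_nhds hz)).hasDerivAt
    refine (hgz.mul (hh z hz).fun_neg.cexp).congr_deriv ?_
    have := hne z hz
    simp only [Pi.div_apply]
    field_simp
    ring
  refine ⟨h, fun z hz => (hh z hz).differentiableAt.differentiableWithinAt, hhc, fun w hw => ?_⟩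
  have hconst := Metric.isOpen_ball.is_const_of_deriv_eq_zero Metric.isPreconnected_ball
    (fun z hz => (hderiv z hz).differentiableAt.differentiableWithinAt)
    (fun z hz => (hderiv z hz).deriv) hw (Metric.mem_ball_self hR)
  rw [hhc, hgc, neg_zero, Complex.exp_zero, one_mul, Complex.exp_neg] at hconst
  exact (mul_inv_eq_one₀ (Complex.exp_ne_zero _)).1 hconst |>.symm

theorem norm_taylorTerm_le_of_re_le {h : ℂ → ℂ} {R A : ℝ} (hR : 0 < R) (hA : 0 < A)
    (hd : DifferentiableOn ℂ h (Metric.ball 0 R)) (h0 : h 0 = 0)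
    (hre : ∀ w ∈ Metric.ball (0 : ℂ) R, (h w).re ≤ A) (k : ℕ) (w : ℂ) :
    ‖iteratedDeriv k h 0 / k.factorial * w ^ k‖ ≤ 2 * A * (2 * ‖w‖ / R) ^ k := by
  have hhalf : ∀ z ∈ Metric.sphere (0 : ℂ) (R / 2), ‖h z‖ ≤ 2 * A := by
    intro z hz
    rw [mem_sphere_zero_iff_norm] at hz
    refine (Complex.borelCaratheodory_zero hA hd hre hR (by simp [hz, hR]) h0).trans_eq ?_
    rw [hz]
    field_simp
    ring
  have hcauchy : ‖iteratedDeriv k h 0‖ ≤ k.factorial * (2 * A) / (R / 2) ^ k :=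
    Complex.norm_iteratedDeriv_le_of_forall_mem_sphere_norm_le k (by positivity)
      (hd.diffContOnCl_ball (Metric.closedBall_subset_ball (by linarith))) hhalf
  rw [norm_mul, norm_div, Complex.norm_natCast, norm_pow]
  calc ‖iteratedDeriv k h 0‖ / k.factorial * ‖w‖ ^ k
      ≤ k.factorial * (2 * A) / (R / 2) ^ k / k.factorial * ‖w‖ ^ k := by gcongr
    _ = 2 * A * (2 * ‖w‖ / R) ^ k := by
      rw [div_pow, div_pow, mul_pow]
      field_simp

theorem norm_sub_taylor_le_of_re_le {h : ℂ → ℂ} {R A : ℝ} (hR : 0 < R) (hA : 0 < A)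
    (hd : DifferentiableOn ℂ h (Metric.ball 0 R)) (h0 : h 0 = 0)
    (hre : ∀ w ∈ Metric.ball (0 : ℂ) R, (h w).re ≤ A) (K : ℕ) {w : ℂ} (hw : ‖w‖ ≤ R / 4) :
    ‖h w - ∑ k ∈ Finset.range K, iteratedDeriv k h 0 / k.factorial * w ^ k‖ ≤
      4 * A * (2 * ‖w‖ / R) ^ K := by
  set x := 2 * ‖w‖ / R with hx
  have hx0 : 0 ≤ x := by positivity
  have hx_half : x ≤ 1 / 2 := by
    rw [hx, div_le_iff₀ hR]
    linarith
  have htaylor : HasSum (fun k : ℕ => iteratedDeriv k h 0 / k.factorial * w ^ k) (h w) := by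
    refine (Complex.hasSum_taylorSeries_on_ball hd (z := w) (by simp; linarith)).congr_fun
      fun k => ?_
    rw [sub_zero, smul_eq_mul, smul_eq_mul]
    ring
  have hgeom : HasSum (fun k : ℕ => 2 * A * x ^ K * x ^ k) (2 * A * x ^ K * (1 - x)⁻¹) :=
    (hasSum_geometric_of_lt_one hx0 (by linarith)).mul_left _
  have hinv : (1 - x)⁻¹ ≤ 2 := inv_le_of_inv_le₀ (by norm_num) (by linarith)
  calc _ ≤ 2 * A * x ^ K * (1 - x)⁻¹ :=
        ((hasSum_nat_add_iff' K).2 htaylor).norm_le_of_bounded hgeom fun k =>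
          (norm_taylorTerm_le_of_re_le hR hA hd h0 hre (k + K) w).trans_eq (by rw [pow_add]; ring)
    _ ≤ 2 * A * x ^ K * 2 := by gcongr
    _ = 4 * A * x ^ K := by ring

theorem norm_one_add_div_sq (r s θ : ℝ) :
    ‖1 + r * Complex.exp (θ * Complex.I) / (s : ℂ)‖ ^ 2 =
      1 + 2 * (r / s) * Real.cos θ + (r / s) ^ 2 := by
  have hcart : 1 + r * Complex.exp (θ * Complex.I) / (s : ℂ) =
      ((1 + r / s * Real.cos θ : ℝ) : ℂ) + ((r / s * Real.sin θ : ℝ) : ℂ) * Complex.I := by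
    rw [Complex.exp_mul_I]
    push_cast
    ring
  rw [hcart, Complex.sq_norm, Complex.normSq_add_mul_I]
  linear_combination (r / s) ^ 2 * Real.sin_sq_add_cos_sq θ

theorem log_norm_one_add_div (r s θ : ℝ) :
    Real.log ‖1 + r * Complex.exp (θ * Complex.I) / (s : ℂ)‖ = primaryLog 0 θ (r / s) := by
  simp [primaryLog, ← norm_one_add_div_sq, Real.log_pow]

theorem genusSum_eq_sum_genusCoeff (Z : Finset ℝ) (ν : ℝ → ℕ) (p : ℕ → ℝ) (N : ℕ) (r α : ℝ) :
    genusSum Z ν p N r α =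
      ∑ k ∈ Finset.Icc 1 N, genusCoeff Z ν p k * (r ^ k * Real.cos (k * α)) +
        ∑ s ∈ Z, ν s * primaryLog 0 α (r / s) := by
  induction N with
  | zero => simp [genusSum]
  | succ N ih =>
    rw [genusSum_succ, ih, Finset.sum_Icc_succ_top (by lia)]
    ring

/-- The multiplicity of `-s` as a zero of `G`. -/
noncomputable def negZeroOrder (G : ℂ → ℂ) (s : ℝ) : ℕ := analyticOrderNatAt G (-(s : ℂ))

/-- The Taylor coefficient of degree `k ≥ 1` at the origin of `log G`, expressed through the
logarithmic derivative so that no branch has to be chosen. -/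
noncomputable def logTaylorCoeff (G : ℂ → ℂ) (k : ℕ) : ℂ :=
  iteratedDeriv (k - 1) (logDeriv G) 0 / k.factorial

/-- On the disc of radius `R` about the origin, the function `G`, normalized by `G 0 = 1`, has the
zeros `-s`, `s ∈ S`, and the holomorphic function `h` is a logarithm of the quotient of `G` by the
polynomial with these zeros. -/
structure HasLogFactor (G h : ℂ → ℂ) (S : Finset ℝ) (R : ℝ) : Prop where
  radius_pos : 0 < R
  pos : ∀ s ∈ S, 0 < s
  differentiableOn : DifferentiableOn ℂ h (Metric.ball 0 R)
  map_zero : h 0 = 0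
  eq_prod_mul_exp : ∀ w ∈ Metric.ball (0 : ℂ) R,
    G w = (∏ s ∈ S, (1 + w / s) ^ negZeroOrder G s) * Complex.exp (h w)

section LogDeriv

variable {𝕜 ι : Type*} [NontriviallyNormedField 𝕜]

theorem logDeriv_prod_one_add_div_pow {S : Finset ι} {c : ι → 𝕜} (hc : ∀ i ∈ S, c i ≠ 0)
    (n : ι → ℕ) {w : 𝕜} (hw : ∏ i ∈ S, (1 + w / c i) ^ n i ≠ 0) :
    logDeriv (fun w => ∏ i ∈ S, (1 + w / c i) ^ n i) w = ∑ i ∈ S, n i * (c i + w)⁻¹ := by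
  rw [logDeriv_prod (f := fun i w => (1 + w / c i) ^ n i) (Finset.prod_ne_zero_iff.1 hw)
    fun i _ => by fun_prop]
  refine Finset.sum_congr rfl fun i hi => ?_
  have hci := hc i hi
  have hlinear : 1 + w / c i = (c i + w) / c i := by field_simp
  rw [logDeriv_fun_pow (by fun_prop), logDeriv_apply,
    show deriv (fun w => 1 + w / c i) w = 1 / c i by simp, hlinear, div_div_div_cancel_right₀ hci,
    one_div]

theorem iteratedDeriv_inv_add (c : 𝕜) (k : ℕ) :
    iteratedDeriv k (fun w => (c + w)⁻¹) 0 = (-1) ^ k * k.factorial / c ^ (k + 1) := by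
  have hlinear : (fun w => (c + w)⁻¹) = fun w => (1 * w + c)⁻¹ := by
    funext w
    rw [one_mul, add_comm]
  rw [iteratedDeriv_eq_iterate, hlinear, iter_deriv_inv_linear,
    show (-1 - (k : ℤ)) = -((k + 1 : ℕ) : ℤ) by push_cast; ring]
  simp only [one_pow, mul_one, mul_zero, zero_add, zpow_neg, zpow_natCast, div_eq_mul_inv]

end LogDeriv

namespace HasLogFactor

variable {G h : ℂ → ℂ} {S : Finset ℝ} {R : ℝ}

theorem logDeriv_eventuallyEq (H : HasLogFactor G h S R) :
    logDeriv G =ᶠ[𝓝 0]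
      fun w => ∑ s ∈ S, (negZeroOrder G s : ℂ) * ((s : ℂ) + w)⁻¹ + deriv h w := by
  set Q : ℂ → ℂ := fun w => ∏ s ∈ S, (1 + w / s) ^ negZeroOrder G s
  have hQ : Differentiable ℂ Q := by fun_prop
  have hQ_ne : ∀ᶠ w in 𝓝 0, Q w ≠ 0 :=
    hQ.continuous.continuousAt.eventually_ne (by simp [Q])
  have hball := Metric.ball_mem_nhds (0 : ℂ) H.radius_pos
  filter_upwards [hQ_ne, hball] with w hw hwR
  have hwR' := Metric.isOpen_ball.mem_nhds hwR
  have hh := (H.differentiableOn.differentiableAt hwR').hasDerivAt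
  have heq : G =ᶠ[𝓝 w] fun w => Q w * Complex.exp (h w) :=
    eventually_of_mem hwR' H.eq_prod_mul_exp
  have hexp : logDeriv (fun w => Complex.exp (h w)) w = deriv h w := by
    rw [logDeriv_apply, hh.cexp.deriv, mul_div_cancel_left₀ _ (Complex.exp_ne_zero _)]
  rw [logDeriv_apply, heq.deriv_eq, heq.eq_of_nhds, ← logDeriv_apply (fun w => Q w * _),
    logDeriv_mul (g := fun w => Complex.exp (h w)) w hw (Complex.exp_ne_zero _) (hQ w)
      hh.cexp.differentiableAt, hexp,
    logDeriv_prod_one_add_div_pow (c := fun s : ℝ => (s : ℂ))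
      (fun s hs => Complex.ofReal_ne_zero.2 (H.pos s hs).ne') _ hw]

theorem iteratedDeriv_div_factorial (H : HasLogFactor G h S R) (k : ℕ) :
    iteratedDeriv (k + 1) h 0 / (k + 1).factorial = logTaylorCoeff G (k + 1) +
      (-1) ^ (k + 1) / (k + 1 : ℕ) * ∑ s ∈ S, (negZeroOrder G s : ℂ) / (s : ℂ) ^ (k + 1) := by
  have hinv : ∀ s ∈ S, ContDiffAt ℂ k (fun w : ℂ => (negZeroOrder G s : ℂ) * ((s : ℂ) + w)⁻¹) 0 :=
    fun s hs => contDiffAt_const.mul <|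
      ContDiffAt.inv (by fun_prop) (by simpa using (H.pos s hs).ne')
  have hh : ContDiffAt ℂ k (deriv h) 0 := (H.differentiableOn.analyticAt
    (Metric.ball_mem_nhds 0 H.radius_pos)).deriv.contDiffAt
  have hpole : ∀ s ∈ S, iteratedDeriv k (fun w : ℂ => (negZeroOrder G s : ℂ) * (s + w)⁻¹) 0 =
      (-1) ^ k * k.factorial * (negZeroOrder G s / (s : ℂ) ^ (k + 1)) := fun s _ => by
    rw [iteratedDeriv_const_mul_field, iteratedDeriv_inv_add]
    ring
  rw [logTaylorCoeff, Nat.add_sub_cancel, H.logDeriv_eventuallyEq.iteratedDeriv_eq,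
    iteratedDeriv_fun_add (ContDiffAt.sum hinv) hh, iteratedDeriv_fun_sum hinv,
    Finset.sum_congr rfl hpole, ← Finset.mul_sum, iteratedDeriv_succ', Nat.factorial_succ]
  have hk : (k.factorial : ℂ) ≠ 0 := Nat.cast_ne_zero.2 k.factorial_ne_zero
  have hk' : ((k + 1 : ℕ) : ℂ) ≠ 0 := Nat.cast_ne_zero.2 k.succ_ne_zero
  rw [Nat.cast_mul]
  field_simp
  ring

theorem genusCoeff_eq (H : HasLogFactor G h S R) {k : ℕ} (hk : 1 ≤ k) :
    genusCoeff S (negZeroOrder G) (fun k => (logTaylorCoeff G k).re) k =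
      (iteratedDeriv k h 0 / k.factorial).re := by
  obtain ⟨k, rfl⟩ := Nat.exists_eq_add_of_le' hk
  rw [H.iteratedDeriv_div_factorial, Complex.add_re, genusCoeff]
  congr 1
  rw [← Complex.ofReal_re ((-1) ^ (k + 1) / (k + 1 : ℕ) * _)]
  push_cast
  rfl

theorem log_norm_eq (H : HasLogFactor G h S R) {r θ : ℝ} (hr : 0 ≤ r) (hrR : r < R)
    (hθ : -1 < Real.cos θ) :
    Real.log ‖G (r * Complex.exp (θ * Complex.I))‖ =
      (h (r * Complex.exp (θ * Complex.I))).re +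
        ∑ s ∈ S, negZeroOrder G s * primaryLog 0 θ (r / s) := by
  have hmem : (r : ℂ) * Complex.exp (θ * Complex.I) ∈ Metric.ball (0 : ℂ) R := by
    simpa [abs_of_nonneg hr, Complex.norm_exp_ofReal_mul_I] using hrR
  have hne : ∀ s ∈ S, ‖(1 + r * Complex.exp (θ * Complex.I) / (s : ℂ)) ^ negZeroOrder G s‖ ≠ 0 := by
    intro s hs
    have hsq := one_add_two_mul_cos_add_sq_pos hθ (div_nonneg hr (H.pos s hs).le)
    rw [← norm_one_add_div_sq] at hsq
    rw [norm_pow]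
    exact pow_ne_zero _ (pow_ne_zero_iff two_ne_zero |>.1 hsq.ne')
  rw [H.eq_prod_mul_exp _ hmem, norm_mul, norm_prod, Complex.norm_exp,
    Real.log_mul (Finset.prod_ne_zero_iff.2 hne) (Real.exp_ne_zero _), Real.log_exp,
    Real.log_prod hne, add_comm]
  simp only [norm_pow, Real.log_pow, log_norm_one_add_div]

end HasLogFactor

section ZeroExtraction

variable {G : ℂ → ℂ} {S : Finset ℝ}

theorem exists_eq_prod_one_add_div_mul (hG : Differentiable ℂ G) (hne : ∃ w, G w ≠ 0)
    (hS : ∀ s ∈ S, s ≠ 0) :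
    ∃ g : ℂ → ℂ, Differentiable ℂ g ∧ (∀ s ∈ S, g (-(s : ℂ)) ≠ 0) ∧
      ∀ w, G w = (∏ s ∈ S, (1 + w / s) ^ negZeroOrder G s) * g w := by
  obtain ⟨g, hg, hgS, hGg⟩ := exists_eq_prod_mul_of_differentiable hG hne
    (S.image fun s : ℝ => -(s : ℂ))
  refine ⟨fun w => (∏ s ∈ S, (s : ℂ) ^ negZeroOrder G s) * g w, hg.const_mul _,
    fun s hs => mul_ne_zero ?_ (hgS _ (Finset.mem_image_of_mem _ hs)), fun w => ?_⟩
  · exact Finset.prod_ne_zero_iff.2 fun t ht => pow_ne_zero _ (Complex.ofReal_ne_zero.2 (hS t ht))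
  · rw [hGg w, Finset.prod_image (fun s _ t _ hst => Complex.ofReal_injective (neg_injective hst)),
      ← mul_assoc, ← Finset.prod_mul_distrib]
    congr 1
    refine Finset.prod_congr rfl fun s hs => ?_
    have hs0 : (s : ℂ) ≠ 0 := Complex.ofReal_ne_zero.2 (hS s hs)
    rw [← mul_pow, add_mul, div_mul_cancel₀ _ hs0, one_mul, sub_neg_eq_add, add_comm, negZeroOrder]

theorem one_le_norm_prod_one_add_div_pow (hS : ∀ s ∈ S, 0 < s) (n : ℝ → ℕ) {w : ℂ}
    (hw : ∀ s ∈ S, 2 * s ≤ ‖w‖) : 1 ≤ ‖∏ s ∈ S, (1 + w / (s : ℂ)) ^ n s‖ := by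
  rw [norm_prod]
  refine Finset.one_le_prod fun s hs => ?_
  rw [norm_pow]
  refine one_le_pow₀ ?_
  have hdiv : 2 ≤ ‖w / (s : ℂ)‖ := by
    rw [norm_div, Complex.norm_real, Real.norm_of_nonneg (hS s hs).le, le_div_iff₀ (hS s hs)]
    exact hw s hs
  have htri := norm_sub_le_norm_add (w / (s : ℂ)) 1
  rw [norm_one, add_comm] at htri
  linarith

theorem norm_quotient_le {g : ℂ → ℂ} (hg : Differentiable ℂ g) (hS : ∀ s ∈ S, 0 < s) {n : ℝ → ℕ}
    (hGg : ∀ w, G w = (∏ s ∈ S, (1 + w / s) ^ n s) * g w) {R B : ℝ} (hSR : ∀ s ∈ S, s < R)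
    (hgrow : ∀ w : ℂ, ‖w‖ = 2 * R → ‖G w‖ ≤ B) {w : ℂ} (hw : w ∈ Metric.ball (0 : ℂ) (2 * R)) :
    ‖g w‖ ≤ B := by
  refine Complex.norm_le_of_forall_mem_frontier_norm_le Metric.isBounded_ball hg.diffContOnCl
    (fun z hz => ?_) (subset_closure hw)
  have hz' : ‖z‖ = 2 * R := mem_sphere_zero_iff_norm.1 (Metric.frontier_ball_subset_sphere hz)
  refine le_trans ?_ (hgrow z hz')
  rw [hGg z, norm_mul]
  exact le_mul_of_one_le_left (norm_nonneg _)
    (one_le_norm_prod_one_add_div_pow hS n fun s hs => by linarith [hSR s hs])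

theorem exists_hasLogFactor (hG : Differentiable ℂ G) (h0 : G 0 = 1)
    (hz : ∀ w, G w = 0 → ∃ s : ℝ, 0 < s ∧ w = -(s : ℂ)) {R A : ℝ} (hR : 0 < R)
    (hgrow : ∀ w : ℂ, ‖w‖ = 2 * R → ‖G w‖ ≤ Real.exp A)
    (hS : ∀ s : ℝ, s ∈ S ↔ 0 < s ∧ s < R ∧ G (-(s : ℂ)) = 0) :
    ∃ h, HasLogFactor G h S R ∧ ∀ w ∈ Metric.ball (0 : ℂ) R, (h w).re ≤ A := by
  have hSpos : ∀ s ∈ S, 0 < s := fun s hs => ((hS s).1 hs).1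
  obtain ⟨g, hg, hgS, hGg⟩ := exists_eq_prod_one_add_div_mul hG ⟨0, by simp [h0]⟩
    fun s hs => (hSpos s hs).ne'
  have hg0 : g 0 = 1 := by simpa [h0] using (hGg 0).symm
  have hgne : ∀ w ∈ Metric.ball (0 : ℂ) R, g w ≠ 0 := by
    intro w hw hgw
    have hGw : G w = 0 := by rw [hGg, hgw, mul_zero]
    obtain ⟨s, hs, rfl⟩ := hz w hGw
    refine hgS s ((hS s).2 ⟨hs, ?_, hGw⟩) hgw
    simpa [abs_of_pos hs] using hw
  obtain ⟨h, hh, hh0, hexp⟩ := exists_exp_eq_on_ball hg.differentiableOn hR hg0 hgne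
  refine ⟨h, ⟨hR, hSpos, hh, hh0, fun w hw => by rw [hexp w hw, hGg w]⟩, fun w hw => ?_⟩
  rw [← Real.exp_le_exp, ← Complex.norm_exp, hexp w hw]
  exact norm_quotient_le hg hSpos hGg (fun s hs => ((hS s).1 hs).2.1) hgrow
    (Metric.ball_subset_ball (by linarith) hw)

end ZeroExtraction

theorem finite_neg_zeros (G : ℂ → ℂ) (hG : Differentiable ℂ G) (hne : ∃ w, G w ≠ 0) (R : ℝ) :
    {s : ℝ | 0 < s ∧ s < R ∧ G (-(s : ℂ)) = 0}.Finite := by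
  obtain ⟨w, hw⟩ := hne
  have hcodiscrete := AnalyticOnNhd.preimage_zero_mem_codiscrete (fun z _ => hG.analyticAt z) hw
  have hfinite := (isCompact_closedBall (0 : ℂ) R).finite_sdiff_of_mem_codiscreteWithin
    (codiscreteWithin_mono (Set.subset_univ _) hcodiscrete)
  refine (hfinite.preimage (f := fun s : ℝ => -(s : ℂ))
    fun s _ t _ hst => Complex.ofReal_injective (neg_injective hst)).subset ?_
  rintro s ⟨hs, hsR, hGs⟩
  simp [hGs, abs_of_pos hs, hsR.le]

/-- The mean of `log ‖G‖` over two complex conjugate points given in polar coordinates. Averaging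
cancels the imaginary parts of the Taylor coefficients of `log G`. -/
noncomputable def symmLogNorm (G : ℂ → ℂ) (r α : ℝ) : ℝ :=
  (Real.log ‖G (r * Complex.exp (α * Complex.I))‖ +
    Real.log ‖G (r * Complex.exp ((-α : ℝ) * Complex.I))‖) / 2

theorem symmLogNorm_angle_zero (G : ℂ → ℂ) (r : ℝ) : symmLogNorm G r 0 = Real.log ‖G r‖ := by
  simp [symmLogNorm]

theorem re_mul_polar_pow (c : ℂ) (r θ : ℝ) (k : ℕ) :
    (c * (r * Complex.exp (θ * Complex.I)) ^ k).re =
      c.re * (r ^ k * Real.cos (k * θ)) - c.im * (r ^ k * Real.sin (k * θ)) := by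
  have hpow : (r * Complex.exp (θ * Complex.I)) ^ k =
      (r ^ k : ℝ) * Complex.exp ((k * θ : ℝ) * Complex.I) := by
    rw [mul_pow, ← Complex.exp_nat_mul]
    push_cast
    ring_nf
  rw [hpow, Complex.mul_re, Complex.re_ofReal_mul, Complex.im_ofReal_mul,
    Complex.exp_ofReal_mul_I_re, Complex.exp_ofReal_mul_I_im]

theorem re_sum_mul_polar_pow_add {c : ℕ → ℂ} (hc : c 0 = 0) (r α : ℝ) (K : ℕ) :
    (∑ k ∈ Finset.range (K + 1), c k * (r * Complex.exp (α * Complex.I)) ^ k).re +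
        (∑ k ∈ Finset.range (K + 1), c k * (r * Complex.exp ((-α : ℝ) * Complex.I)) ^ k).re =
      2 * ∑ k ∈ Finset.Icc 1 K, (c k).re * (r ^ k * Real.cos (k * α)) := by
  simp only [Finset.sum_range_eq_add_Ico _ K.add_one_pos, hc, zero_mul, zero_add,
    Finset.Ico_add_one_right_eq_Icc, Complex.re_sum, ← Finset.sum_add_distrib, Finset.mul_sum,
    re_mul_polar_pow, mul_neg, Real.cos_neg, Real.sin_neg]
  exact Finset.sum_congr rfl fun k _ => by ring

theorem HasLogFactor.symmLogNorm_sub_genusSum {G h : ℂ → ℂ} {S : Finset ℝ} {R : ℝ}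
    (H : HasLogFactor G h S R) (K : ℕ) {r α : ℝ} (hr : 0 ≤ r) (hrR : r < R)
    (hα : -1 < Real.cos α) :
    let T : ℂ → ℂ := fun w => ∑ k ∈ Finset.range (K + 1), iteratedDeriv k h 0 / k.factorial * w ^ k
    symmLogNorm G r α -
        genusSum S (negZeroOrder G) (fun k => (logTaylorCoeff G k).re) K r α =
      ((h (r * Complex.exp (α * Complex.I)) - T (r * Complex.exp (α * Complex.I))).re +
        (h (r * Complex.exp ((-α : ℝ) * Complex.I)) -
          T (r * Complex.exp ((-α : ℝ) * Complex.I))).re) / 2 := by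
  intro T
  have hT : (T (r * Complex.exp (α * Complex.I))).re +
      (T (r * Complex.exp ((-α : ℝ) * Complex.I))).re = 2 * ∑ k ∈ Finset.Icc 1 K,
        (iteratedDeriv k h 0 / k.factorial).re * (r ^ k * Real.cos (k * α)) :=
    re_sum_mul_polar_pow_add (by simp [H.map_zero]) r α K
  have hcoeff : ∑ k ∈ Finset.Icc 1 K, genusCoeff S (negZeroOrder G)
        (fun k => (logTaylorCoeff G k).re) k * (r ^ k * Real.cos (k * α)) =
      ∑ k ∈ Finset.Icc 1 K,
        (iteratedDeriv k h 0 / k.factorial).re * (r ^ k * Real.cos (k * α)) :=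
    Finset.sum_congr rfl fun k hk => by rw [H.genusCoeff_eq (Finset.mem_Icc.1 hk).1]
  have hneg : ∀ x, primaryLog 0 (-α) x = primaryLog 0 α x := by simp [primaryLog]
  rw [genusSum_eq_sum_genusCoeff, hcoeff, symmLogNorm, H.log_norm_eq hr hrR hα,
    H.log_norm_eq hr hrR (by rwa [Real.cos_neg]), Complex.sub_re, Complex.sub_re]
  simp only [hneg]
  linarith

theorem HasLogFactor.abs_symmLogNorm_sub_genusSum_le {G h : ℂ → ℂ} {S : Finset ℝ} {R A : ℝ}
    (H : HasLogFactor G h S R) (hA : 0 < A) (hre : ∀ w ∈ Metric.ball (0 : ℂ) R, (h w).re ≤ A)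
    (K : ℕ) {r α : ℝ} (hr : 0 ≤ r) (hrR : r ≤ R / 4) (hα : -1 < Real.cos α) :
    |symmLogNorm G r α -
        genusSum S (negZeroOrder G) (fun k => (logTaylorCoeff G k).re) K r α| ≤
      4 * A * (2 * r / R) ^ (K + 1) := by
  have hR := H.radius_pos
  have hnorm : ∀ θ : ℝ, ‖(r : ℂ) * Complex.exp (θ * Complex.I)‖ = r := fun θ => by
    simp [Complex.norm_exp_ofReal_mul_I, abs_of_nonneg hr]
  have htaylor : ∀ θ : ℝ, |(h (r * Complex.exp (θ * Complex.I)) -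
      ∑ k ∈ Finset.range (K + 1), iteratedDeriv k h 0 / k.factorial *
        (r * Complex.exp (θ * Complex.I)) ^ k).re| ≤ 4 * A * (2 * r / R) ^ (K + 1) := fun θ => by
    have hbound := norm_sub_taylor_le_of_re_le hR hA H.differentiableOn H.map_zero hre (K + 1)
      ((hnorm θ).trans_le hrR)
    rw [hnorm] at hbound
    exact (Complex.abs_re_le_norm _).trans hbound
  rw [H.symmLogNorm_sub_genusSum K hr (by linarith) hα]
  have hplus := abs_le.1 (htaylor α)
  have hminus := abs_le.1 (htaylor (-α))
  exact abs_le.2 ⟨by linarith [hplus.1, hminus.1], by linarith [hplus.2, hminus.2]⟩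

section ExponentialType

variable {G : ℂ → ℂ}

theorem hasGenusRep_symmLogNorm (hG : Differentiable ℂ G) (h0 : G 0 = 1)
    (hz : ∀ w, G w = 0 → ∃ s : ℝ, 0 < s ∧ w = -(s : ℂ)) {C : ℝ} {N : ℕ}
    (hgrow : ∀ w, ‖G w‖ ≤ Real.exp (C * (1 + ‖w‖) ^ N)) {Z : ℕ → Finset ℝ}
    (hZ : ∀ n s, s ∈ Z n ↔ 0 < s ∧ s < n ∧ G (-(s : ℂ)) = 0) :
    HasGenusRep Z (negZeroOrder G) (fun k => (logTaylorCoeff G k).re) (N + 1) (symmLogNorm G) := by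
  intro r hr α hα
  have herror : ∀ᶠ n : ℕ in atTop, |symmLogNorm G r α - genusSum (Z n) (negZeroOrder G)
      (fun k => (logTaylorCoeff G k).re) (N + 1) r α| ≤
        4 * ((|C| + 1) * (3 * n) ^ N) * (2 * r / n) ^ (N + 2) := by
    filter_upwards [eventually_ge_atTop 1, eventually_ge_atTop ⌈4 * r⌉₊] with n hn hnr
    have hn1 : (1 : ℝ) ≤ n := Nat.one_le_cast.2 hn
    have hgrow_sphere : ∀ w : ℂ, ‖w‖ = 2 * n → ‖G w‖ ≤ Real.exp ((|C| + 1) * (3 * n) ^ N) := by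
      intro w hw
      refine (hgrow w).trans (Real.exp_le_exp.2 ?_)
      have hC : C ≤ |C| + 1 := by linarith [le_abs_self C]
      rw [hw]
      gcongr
      linarith
    obtain ⟨h, H, hre⟩ := exists_hasLogFactor hG h0 hz (by linarith) hgrow_sphere (hZ n)
    exact H.abs_symmLogNorm_sub_genusSum_le (by positivity) hre (N + 1) hr
      (by linarith [Nat.ceil_le.1 hnr]) hα
  have hlim : Tendsto (fun n : ℕ => 4 * ((|C| + 1) * (3 * n) ^ N) * (2 * r / n) ^ (N + 2)) atTop
      (𝓝 0) := by
    have hinv := tendsto_one_div_atTop_nhds_zero_nat (𝕜 := ℝ)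
    have hsq := (hinv.mul hinv).const_mul (4 * (|C| + 1) * 3 ^ N * (2 * r) ^ (N + 2))
    rw [mul_zero, mul_zero] at hsq
    refine hsq.congr' ?_
    filter_upwards [eventually_ne_atTop 0] with n hn
    have hn0 : (n : ℝ) ≠ 0 := Nat.cast_ne_zero.2 hn
    rw [mul_pow, div_pow]
    field_simp
    ring
  rw [tendsto_iff_dist_tendsto_zero]
  simp only [dist_comm _ (symmLogNorm G r α), Real.dist_eq]
  exact squeeze_zero' (Eventually.of_forall fun _ => abs_nonneg _) herror hlim

theorem isRidge_symmLogNorm (hpos : ∀ r : ℝ, 0 ≤ r → 1 ≤ ‖G r‖)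
    (hridge : ∀ r β : ℝ, 0 ≤ r →
      ‖G (r * Complex.exp ((2 * β : ℝ) * Complex.I))‖ ≤ ‖G ((r * Real.cos β ^ 2 : ℝ) : ℂ)‖) :
    IsRidge (symmLogNorm G) where
  nonneg r hr := by
    rw [symmLogNorm_angle_zero]
    exact Real.log_nonneg (hpos r hr)
  le r β hr _ := by
    have hlog : ∀ β : ℝ, Real.log ‖G (r * Complex.exp ((2 * β : ℝ) * Complex.I))‖ ≤
        Real.log ‖G ((r * Real.cos β ^ 2 : ℝ) : ℂ)‖ := fun β => by
      rcases (norm_nonneg (G (r * Complex.exp ((2 * β : ℝ) * Complex.I)))).eq_or_lt with hG0 | hG0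
      · rw [← hG0, Real.log_zero]
        exact Real.log_nonneg (hpos _ (by positivity))
      · exact Real.log_le_log hG0 (hridge r β hr)
    have hminus := hlog (-β)
    rw [Real.cos_neg, mul_neg] at hminus
    rw [symmLogNorm_angle_zero, symmLogNorm]
    linarith [hlog β]

theorem exists_norm_le_exp_mul_of_ridge (hG : Differentiable ℂ G) (h0 : G 0 = 1)
    (hz : ∀ w, G w = 0 → ∃ s : ℝ, 0 < s ∧ w = -(s : ℂ)) {C : ℝ} {N : ℕ}
    (hgrow : ∀ w, ‖G w‖ ≤ Real.exp (C * (1 + ‖w‖) ^ N)) (hpos : ∀ r : ℝ, 0 ≤ r → 1 ≤ ‖G r‖)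
    (hridge : ∀ r β : ℝ, 0 ≤ r →
      ‖G (r * Complex.exp ((2 * β : ℝ) * Complex.I))‖ ≤ ‖G ((r * Real.cos β ^ 2 : ℝ) : ℂ)‖) :
    ∃ A : ℝ, ∀ r : ℝ, 0 ≤ r → ‖G r‖ ≤ Real.exp (A * r) := by
  obtain ⟨Z, hZ⟩ : ∃ Z : ℕ → Finset ℝ, ∀ n s, s ∈ Z n ↔ 0 < s ∧ s < n ∧ G (-(s : ℂ)) = 0 :=
    ⟨fun n => (finite_neg_zeros G hG ⟨0, by simp [h0]⟩ n).toFinset, by simp⟩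
  have hZmono : Monotone Z := fun m n hmn s hs => by
    obtain ⟨hs0, hsm, hGs⟩ := (hZ m s).1 hs
    exact (hZ n s).2 ⟨hs0, hsm.trans_le (Nat.cast_le.2 hmn), hGs⟩
  refine ⟨(logTaylorCoeff G 1).re, fun r hr =>
    (Real.log_le_iff_le_exp (by linarith [hpos r hr])).1 ?_⟩
  rw [← symmLogNorm_angle_zero]
  exact (hasGenusRep_symmLogNorm hG h0 hz hgrow hZ).le_mul hZmono
    (fun n s hs => ((hZ n s).1 hs).1) (isRidge_symmLogNorm hpos hridge) (by lia) hr

end ExponentialType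

section EvenFunction

variable {F : ℂ → ℂ}

theorem eq_of_even_of_sq_eq_sq (heven : F.Even) {z w : ℂ} (h : z ^ 2 = w ^ 2) : F z = F w := by
  rcases sq_eq_sq_iff_eq_or_eq_neg.1 h with rfl | rfl
  · rfl
  · exact heven w

theorem differentiableAt_comp_cpow_half_of_even (hF : Differentiable ℂ F) (heven : F.Even) {w : ℂ}
    (hw : w ≠ 0) : DifferentiableAt ℂ (fun v => F (v ^ (1 / 2 : ℂ))) w := by
  by_cases hslit : w ∈ Complex.slitPlane
  · exact (hF _).comp w (differentiableAt_id.cpow_const hslit)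
  · have hneg : -w ∈ Complex.slitPlane := by
      rw [Complex.mem_slitPlane_iff] at hslit
      push Not at hslit
      have hre : w.re ≠ 0 := fun h => hw (Complex.ext h hslit.2)
      exact Or.inl (neg_pos.2 (lt_of_le_of_ne hslit.1 hre))
    -- On the branch cut, `I * (-v) ^ (1 / 2)` is a square root of `v` that is differentiable.
    have hbranch : (fun v => F (v ^ (1 / 2 : ℂ))) =
        fun v => F (Complex.I * (-v) ^ (1 / 2 : ℂ)) := by
      funext v
      refine eq_of_even_of_sq_eq_sq heven ?_
      simp [mul_pow]
    rw [hbranch]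
    exact (hF _).comp w ((differentiableAt_id.neg.cpow_const hneg).const_mul _)

theorem exists_comp_sq_eq_of_even (hF : Differentiable ℂ F) (heven : F.Even) :
    ∃ G : ℂ → ℂ, Differentiable ℂ G ∧ ∀ z, G (z ^ 2) = F z := by
  refine ⟨fun w => F (w ^ (1 / 2 : ℂ)), fun w => ?_,
    fun z => eq_of_even_of_sq_eq_sq heven (by simp)⟩
  rcases eq_or_ne w 0 with rfl | hw
  · refine (Complex.analyticAt_of_differentiable_on_punctured_nhds_of_continuousAt
      ?_ ?_).differentiableAt
    · filter_upwards [self_mem_nhdsWithin] with v hv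
      exact differentiableAt_comp_cpow_half_of_even hF heven hv
    · exact ContinuousAt.comp (g := F) hF.continuous.continuousAt
        (Complex.continuousAt_cpow_const_of_re_pos (by simp) (by norm_num))
  · exact differentiableAt_comp_cpow_half_of_even hF heven hw

end EvenFunction

section RidgeFunction

variable {f G : ℂ → ℂ}

theorem exists_pos_eq_neg_of_zero_of_comp_sq_eq (hGf : ∀ z, G (z ^ 2) = f z * f (-z))
    (h0 : f 0 ≠ 0) (hzero : ∀ z, f z = 0 → z.re = 0) {w : ℂ} (hw : G w = 0) :
    ∃ s : ℝ, 0 < s ∧ w = -(s : ℂ) := by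
  obtain ⟨z, rfl⟩ := IsAlgClosed.exists_pow_nat_eq w two_pos
  rw [hGf, mul_eq_zero] at hw
  have hre : z.re = 0 := hw.elim (hzero z) fun h => by simpa using hzero _ h
  have him : z.im ≠ 0 := fun h => by simp [show z = 0 from Complex.ext hre h, h0] at hw
  refine ⟨z.im ^ 2, by positivity, ?_⟩
  have hz : z = z.im * Complex.I := Complex.ext (by simp [hre]) (by simp)
  conv_lhs => rw [hz, mul_pow, Complex.I_sq]
  push_cast
  ring

theorem norm_comp_sq_le_of_ridge (hGf : ∀ z, G (z ^ 2) = f z * f (-z))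
    (hridge : ∀ z : ℂ, ‖f z‖ ≤ ‖f z.re‖) (z : ℂ) :
    ‖G (z ^ 2)‖ ≤ ‖G ((z.re ^ 2 : ℝ) : ℂ)‖ := by
  have hneg := hridge (-z)
  rw [Complex.neg_re, Complex.ofReal_neg] at hneg
  rw [Complex.ofReal_pow, hGf, hGf, norm_mul, norm_mul]
  exact mul_le_mul (hridge z) hneg (norm_nonneg _) (norm_nonneg _)

theorem norm_polar_le_of_ridge (hGf : ∀ z, G (z ^ 2) = f z * f (-z))
    (hridge : ∀ z : ℂ, ‖f z‖ ≤ ‖f z.re‖) {r : ℝ} (hr : 0 ≤ r) (β : ℝ) :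
    ‖G (r * Complex.exp ((2 * β : ℝ) * Complex.I))‖ ≤ ‖G ((r * Real.cos β ^ 2 : ℝ) : ℂ)‖ := by
  have h := norm_comp_sq_le_of_ridge hGf hridge (√r * Complex.exp (β * Complex.I))
  have hsq : (√r * Complex.exp (β * Complex.I)) ^ 2 =
      r * Complex.exp ((2 * β : ℝ) * Complex.I) := by
    rw [mul_pow, ← Complex.ofReal_pow, Real.sq_sqrt hr, ← Complex.exp_nat_mul]
    push_cast
    ring_nf
  rwa [Complex.re_ofReal_mul, Complex.exp_ofReal_mul_I_re, hsq, mul_pow, Real.sq_sqrt hr] at h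

theorem norm_le_exp_of_ridge_of_growth (hGf : ∀ z, G (z ^ 2) = f z * f (-z))
    (hridge : ∀ z : ℂ, ‖f z‖ ≤ ‖f z.re‖) {C : ℝ} (hC : 0 ≤ C) {N : ℕ}
    (hgrow : ∀ x : ℝ, ‖f x‖ ≤ Real.exp (C * (1 + |x|) ^ N)) (w : ℂ) :
    ‖G w‖ ≤ Real.exp (2 * C * 2 ^ N * (1 + ‖w‖) ^ N) := by
  obtain ⟨z, rfl⟩ := IsAlgClosed.exists_pow_nat_eq w two_pos
  have hre : |z.re| ≤ 1 + 2 * ‖z ^ 2‖ := by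
    rw [norm_pow]
    nlinarith [Complex.abs_re_le_norm z, sq_nonneg (‖z‖ - 1), norm_nonneg z]
  have hneg := hgrow (-z.re)
  rw [Complex.ofReal_neg, abs_neg] at hneg
  calc ‖G (z ^ 2)‖ ≤ ‖f z.re‖ * ‖f (-z.re)‖ := by
        simpa only [Complex.ofReal_pow, hGf, norm_mul] using norm_comp_sq_le_of_ridge hGf hridge z
    _ ≤ Real.exp (C * (1 + |z.re|) ^ N) * Real.exp (C * (1 + |z.re|) ^ N) := by
        gcongr
        exact hgrow z.re
    _ = Real.exp (2 * C * (1 + |z.re|) ^ N) := by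
        rw [← Real.exp_add]
        ring_nf
    _ ≤ Real.exp (2 * C * (2 * (1 + ‖z ^ 2‖)) ^ N) := by
        gcongr
        linarith
    _ = Real.exp (2 * C * 2 ^ N * (1 + ‖z ^ 2‖) ^ N) := by
        rw [mul_pow, mul_assoc _ (2 ^ N)]

theorem exists_norm_mul_norm_neg_le_exp_mul_sq (hf : Differentiable ℂ f) (h0 : f 0 = 1)
    (hridge : ∀ z : ℂ, ‖f z‖ ≤ ‖f z.re‖) (hzero : ∀ z, f z = 0 → z.re = 0)
    {C : ℝ} (hC : 0 ≤ C) {N : ℕ} (hgrow : ∀ x : ℝ, ‖f x‖ ≤ Real.exp (C * (1 + |x|) ^ N))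
    (hone : ∀ x : ℝ, 1 ≤ ‖f x‖ * ‖f (-x)‖) :
    ∃ A : ℝ, ∀ x : ℝ, ‖f x‖ * ‖f (-x)‖ ≤ Real.exp (A * x ^ 2) := by
  obtain ⟨G, hG, hGf⟩ := exists_comp_sq_eq_of_even (F := fun z => f z * f (-z))
    (hf.mul (hf.comp differentiable_neg)) fun z => by simp only [neg_neg, mul_comm]
  have hreal : ∀ x : ℝ, ‖G ((x ^ 2 : ℝ) : ℂ)‖ = ‖f x‖ * ‖f (-x)‖ := fun x => by
    rw [Complex.ofReal_pow, hGf, norm_mul]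
  have hpos : ∀ r : ℝ, 0 ≤ r → 1 ≤ ‖G r‖ := fun r hr => by
    simpa only [← hreal, Real.sq_sqrt hr] using hone √r
  have hG0 : G 0 = 1 := by simpa [h0] using hGf 0
  obtain ⟨A, hA⟩ := exists_norm_le_exp_mul_of_ridge hG hG0
    (fun w => exists_pos_eq_neg_of_zero_of_comp_sq_eq hGf (by simp [h0]) hzero)
    (norm_le_exp_of_ridge_of_growth hGf hridge hC hgrow) hpos
    fun r β hr => norm_polar_le_of_ridge hGf hridge hr β
  exact ⟨A, fun x => (hreal x).symm.trans_le (hA (x ^ 2) (sq_nonneg x))⟩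

end RidgeFunction

section StretchedExponential

variable {Ω : Type*} [MeasurableSpace Ω] {P : Measure Ω} {X : Ω → ℝ} {a b : ℝ}

theorem mul_le_mul_rpow_add (hb : 0 < b) (ha : 1 < a) {t x : ℝ} (ht : 0 ≤ t) (hx : 0 ≤ x) :
    t * x ≤ b * x ^ a + t * (t / b) ^ (1 / (a - 1)) := by
  have ha' : 0 < a - 1 := by linarith
  rcases le_total t (b * x ^ (a - 1)) with h | h
  · have hpow : x ^ (a - 1) * x = x ^ a := by
      nth_rewrite 2 [← Real.rpow_one x]
      rw [← Real.rpow_add' hx (by linarith), sub_add_cancel]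
    calc t * x ≤ b * x ^ (a - 1) * x := by gcongr
      _ = b * x ^ a := by rw [mul_assoc, hpow]
      _ ≤ b * x ^ a + t * (t / b) ^ (1 / (a - 1)) := le_add_of_nonneg_right (by positivity)
  · calc t * x = t * (x ^ (a - 1)) ^ (1 / (a - 1)) := by
          rw [← Real.rpow_mul hx, mul_one_div_cancel ha'.ne', Real.rpow_one]
      _ ≤ t * (t / b) ^ (1 / (a - 1)) := by
          gcongr
          rwa [le_div_iff₀' hb]
      _ ≤ b * x ^ a + t * (t / b) ^ (1 / (a - 1)) := le_add_of_nonneg_left (by positivity)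

theorem exp_mul_le_of_rpow (hb : 0 < b) (ha : 1 < a) (t x : ℝ) :
    Real.exp (t * x) ≤
      Real.exp (|t| * (|t| / b) ^ (1 / (a - 1))) * Real.exp (b * |x| ^ a) := by
  rw [← Real.exp_add, Real.exp_le_exp, add_comm]
  calc t * x ≤ |t| * |x| := abs_mul t x ▸ le_abs_self _
    _ ≤ _ := mul_le_mul_rpow_add hb ha (abs_nonneg t) (abs_nonneg x)

theorem integrable_exp_mul_of_rpow (hX : AEMeasurable X P) (hb : 0 < b) (ha : 1 < a)
    (h : Integrable (fun ω => Real.exp (b * |X ω| ^ a)) P) (t : ℝ) :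
    Integrable (fun ω => Real.exp (t * X ω)) P := by
  have hmeas : AEMeasurable (fun ω => Real.exp (t * X ω)) P := by fun_prop
  refine (h.const_mul (Real.exp (|t| * (|t| / b) ^ (1 / (a - 1))))).mono'
    hmeas.aestronglyMeasurable (Eventually.of_forall fun ω => ?_)
  rw [Real.norm_of_nonneg (Real.exp_pos _).le]
  exact exp_mul_le_of_rpow hb ha t (X ω)

theorem mgf_le_of_rpow (hX : AEMeasurable X P) (hb : 0 < b) (ha : 1 < a)
    (h : Integrable (fun ω => Real.exp (b * |X ω| ^ a)) P) (t : ℝ) :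
    mgf X P t ≤ Real.exp (|t| * (|t| / b) ^ (1 / (a - 1))) * ∫ ω, Real.exp (b * |X ω| ^ a) ∂P := by
  rw [mgf, ← integral_const_mul]
  exact integral_mono (integrable_exp_mul_of_rpow hX hb ha h t) (h.const_mul _)
    fun ω => exp_mul_le_of_rpow hb ha t (X ω)

theorem mul_div_rpow_le {γ t : ℝ} (hb : 0 < b) (hγ : 0 ≤ γ) (ht : 0 ≤ t) :
    t * (t / b) ^ γ ≤ (1 / b) ^ γ * (1 + t) ^ (⌈γ⌉₊ + 1) := by
  have hpow : t ^ γ ≤ (1 + t) ^ ⌈γ⌉₊ :=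
    calc t ^ γ ≤ (1 + t) ^ γ := by
          gcongr
          linarith
      _ ≤ (1 + t) ^ (⌈γ⌉₊ : ℝ) :=
          Real.rpow_le_rpow_of_exponent_le (by linarith) (Nat.le_ceil γ)
      _ = (1 + t) ^ ⌈γ⌉₊ := Real.rpow_natCast _ _
  calc t * (t / b) ^ γ = (1 / b) ^ γ * (t ^ γ * t) := by
        rw [div_eq_mul_one_div, Real.mul_rpow ht (by positivity)]
        ring
    _ ≤ (1 / b) ^ γ * ((1 + t) ^ ⌈γ⌉₊ * (1 + t)) := by
        gcongr
        linarith
    _ = (1 / b) ^ γ * (1 + t) ^ (⌈γ⌉₊ + 1) := by rw [pow_succ]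

theorem exists_mgf_le_exp_pow (hX : AEMeasurable X P) (hb : 0 < b) (ha : 1 < a)
    (h : Integrable (fun ω => Real.exp (b * |X ω| ^ a)) P) :
    ∃ (C : ℝ) (N : ℕ), 0 ≤ C ∧ ∀ t, mgf X P t ≤ Real.exp (C * (1 + |t|) ^ N) := by
  set γ := 1 / (a - 1)
  have hγ : 0 ≤ γ := one_div_nonneg.2 (by linarith)
  set J := ∫ ω, Real.exp (b * |X ω| ^ a) ∂P
  have hJ : 0 ≤ J := integral_nonneg fun ω => (Real.exp_pos _).le
  refine ⟨(1 / b) ^ γ + J, ⌈γ⌉₊ + 1, by positivity, fun t => ?_⟩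
  calc mgf X P t ≤ Real.exp (|t| * (|t| / b) ^ γ) * J := mgf_le_of_rpow hX hb ha h t
    _ ≤ Real.exp (|t| * (|t| / b) ^ γ) * Real.exp J := by
        gcongr
        linarith [Real.add_one_le_exp J]
    _ = Real.exp (|t| * (|t| / b) ^ γ + J) := (Real.exp_add _ _).symm
    _ ≤ Real.exp (((1 / b) ^ γ + J) * (1 + |t|) ^ (⌈γ⌉₊ + 1)) := by
        rw [Real.exp_le_exp, add_mul]
        exact add_le_add (mul_div_rpow_le hb hγ (abs_nonneg t))
          (le_mul_of_one_le_right hJ (one_le_pow₀ (by linarith [abs_nonneg t])))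

end StretchedExponential

section Subgaussian

variable {Ω : Type*} [MeasurableSpace Ω] {P : Measure Ω} {X : Ω → ℝ}

theorem exp_mul_integral_le_mgf [IsProbabilityMeasure P]
    (hint : ∀ t, Integrable (fun ω => Real.exp (t * X ω)) P) (t : ℝ) :
    Real.exp (t * P[X]) ≤ mgf X P t := by
  have hX : Integrable X P := by
    simpa using integrable_pow_of_integrable_exp_mul one_ne_zero (hint 1) (hint (-1)) 1
  rw [← integral_const_mul]
  exact convexOn_exp.map_integral_le Real.continuous_exp.continuousOn isClosed_univ (by simp)
    (hX.const_mul t) (hint t)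

theorem one_le_mgf_mul_mgf_neg [IsProbabilityMeasure P]
    (hint : ∀ t, Integrable (fun ω => Real.exp (t * X ω)) P) (t : ℝ) :
    1 ≤ mgf X P t * mgf X P (-t) :=
  calc (1 : ℝ) = Real.exp (t * P[X]) * Real.exp (-t * P[X]) := by simp [← Real.exp_add]
    _ ≤ mgf X P t * mgf X P (-t) :=
        mul_le_mul (exp_mul_integral_le_mgf hint t) (exp_mul_integral_le_mgf hint (-t))
          (Real.exp_pos _).le mgf_nonneg

theorem hasSubgaussianMGF_sub_integral_of_mgf_mul_mgf_neg_le [IsProbabilityMeasure P]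
    (hint : ∀ t, Integrable (fun ω => Real.exp (t * X ω)) P) {A : ℝ}
    (h : ∀ t, mgf X P t * mgf X P (-t) ≤ Real.exp (A * t ^ 2)) :
    HasSubgaussianMGF (fun ω => X ω - P[X]) (2 * A.toNNReal) P where
  integrable_exp_mul t := by
    simp only [mul_sub, Real.exp_sub]
    exact (hint t).div_const _
  mgf_le t :=
    calc mgf (fun ω => X ω - P[X]) P t = mgf X P t * Real.exp (-t * P[X]) := by
          simp only [sub_eq_add_neg, mgf_add_const, mul_neg, neg_mul]
      _ ≤ mgf X P t * mgf X P (-t) :=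
          mul_le_mul_of_nonneg_left (exp_mul_integral_le_mgf hint (-t)) mgf_nonneg
      _ ≤ Real.exp (A * t ^ 2) := h t
      _ ≤ Real.exp ((2 * A.toNNReal : NNReal) * t ^ 2 / 2) := by
          rw [Real.exp_le_exp, NNReal.coe_mul, NNReal.coe_ofNat]
          linarith [mul_le_mul_of_nonneg_right (Real.le_coe_toNNReal A) (sq_nonneg t)]

theorem exists_hasSubgaussianMGF_of_complexMGF_ne_zero [IsProbabilityMeasure P]
    (hint : ∀ t, Integrable (fun ω => Real.exp (t * X ω)) P) {C : ℝ} (hC : 0 ≤ C) {N : ℕ}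
    (hgrow : ∀ t, mgf X P t ≤ Real.exp (C * (1 + |t|) ^ N))
    (hne : ∀ z : ℂ, z.re ≠ 0 → complexMGF X P z ≠ 0) :
    ∃ c, HasSubgaussianMGF (fun ω => X ω - P[X]) c P := by
  have hreal : ∀ x : ℝ, ‖complexMGF X P x‖ = mgf X P x := fun x => by
    rw [complexMGF_ofReal, Complex.norm_real, Real.norm_of_nonneg mgf_nonneg]
  have hreal_neg : ∀ x : ℝ, ‖complexMGF X P (-x)‖ = mgf X P (-x) := fun x => by
    rw [← Complex.ofReal_neg, hreal]
  have huniv : integrableExpSet X P = Set.univ := Set.eq_univ_of_forall hint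
  have hdiff : Differentiable ℂ (complexMGF X P) := fun z =>
    (hasDerivAt_complexMGF (by simp [huniv])).differentiableAt
  obtain ⟨A, hA⟩ := exists_norm_mul_norm_neg_le_exp_mul_sq hdiff (by simp [complexMGF])
    (fun z => (hreal z.re).symm ▸ norm_complexMGF_le_mgf) (fun z => not_imp_not.1 (hne z))
    hC (fun x => (hreal x).trans_le (hgrow x))
    fun x => by simpa only [hreal, hreal_neg] using one_le_mgf_mul_mgf_neg hint x
  simp only [hreal, hreal_neg] at hA
  exact ⟨_, hasSubgaussianMGF_sub_integral_of_mgf_mul_mgf_neg_le hint hA⟩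

theorem lintegral_exp_mul_gaussianReal (v : NNReal) (x : ℝ) :
    ∫⁻ g, ENNReal.ofReal (Real.exp (x * g)) ∂gaussianReal 0 v =
      ENNReal.ofReal (Real.exp (v * x ^ 2 / 2)) := by
  rw [← ofReal_integral_eq_lintegral_ofReal (integrable_exp_mul_gaussianReal x)
    (Eventually.of_forall fun g => (Real.exp_pos _).le)]
  congr 1
  simpa only [zero_mul, zero_add, mgf, id_eq] using
    congrFun (mgf_id_gaussianReal (μ := 0) (v := v)) x

theorem lintegral_exp_mul_sq_gaussianReal_lt_top {v c : NNReal} (hv : v ≠ 0) (hvc : v * c < 1) :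
    ∫⁻ g, ENNReal.ofReal (Real.exp (c * g ^ 2 / 2)) ∂gaussianReal 0 v < ⊤ := by
  have hv0 : (0 : ℝ) < v := NNReal.coe_pos.2 (pos_iff_ne_zero.2 hv)
  have hδ : 0 < (1 - v * c) / (2 * v : ℝ) :=
    div_pos (sub_pos.2 (mod_cast hvc)) (mul_pos two_pos hv0)
  rw [gaussianReal_of_var_ne_zero 0 hv,
    lintegral_withDensity_eq_lintegral_mul _ (by fun_prop) (by fun_prop)]
  have hpdf : ∀ g : ℝ, (gaussianPDF 0 v * fun g => ENNReal.ofReal (Real.exp (c * g ^ 2 / 2))) g =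
      ENNReal.ofReal ((√(2 * Real.pi * v))⁻¹ * Real.exp (-((1 - v * c) / (2 * v)) * g ^ 2)) := by
    intro g
    rw [Pi.mul_apply, gaussianPDF, gaussianPDFReal, ← ENNReal.ofReal_mul (by positivity),
      mul_assoc, ← Real.exp_add]
    congr 3
    field_simp
    ring
  simp only [hpdf]
  exact ((integrable_exp_neg_mul_sq hδ).const_mul _).lintegral_lt_top

theorem lintegral_exp_mul_sq_lt_top_of_hasSubgaussianMGF {v c : NNReal}
    (h : HasSubgaussianMGF X c P) (hv : v ≠ 0) (hvc : v * c < 1) :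
    ∫⁻ ω, ENNReal.ofReal (Real.exp (v * X ω ^ 2 / 2)) ∂P < ⊤ := by
  have hfinite : IsFiniteMeasure P := by
    simpa [integrable_const_iff] using h.integrable_exp_mul 0
  have hX : AEMeasurable (fun z : Ω × ℝ => X z.1) (P.prod (gaussianReal 0 v)) :=
    h.aemeasurable.comp_quasiMeasurePreserving Measure.quasiMeasurePreserving_fst
  calc ∫⁻ ω, ENNReal.ofReal (Real.exp (v * X ω ^ 2 / 2)) ∂P
      = ∫⁻ ω, ∫⁻ g, ENNReal.ofReal (Real.exp (X ω * g)) ∂gaussianReal 0 v ∂P := by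
        simp only [lintegral_exp_mul_gaussianReal]
    _ = ∫⁻ g, ∫⁻ ω, ENNReal.ofReal (Real.exp (X ω * g)) ∂P ∂gaussianReal 0 v :=
        lintegral_lintegral_swap (hX.mul measurable_snd.aemeasurable).exp.ennreal_ofReal
    _ = ∫⁻ g, ENNReal.ofReal (mgf X P g) ∂gaussianReal 0 v := by
        refine lintegral_congr fun g => ?_
        rw [mgf, ofReal_integral_eq_lintegral_ofReal (h.integrable_exp_mul g)
          (Eventually.of_forall fun ω => (Real.exp_pos _).le)]
        simp only [mul_comm]
    _ ≤ ∫⁻ g, ENNReal.ofReal (Real.exp (c * g ^ 2 / 2)) ∂gaussianReal 0 v :=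
        lintegral_mono fun g => ENNReal.ofReal_le_ofReal (h.mgf_le g)
    _ < ⊤ := lintegral_exp_mul_sq_gaussianReal_lt_top hv hvc

theorem exists_lintegral_exp_mul_sq_lt_top {c : NNReal} {m : ℝ}
    (h : HasSubgaussianMGF (fun ω => X ω - m) c P) :
    ∃ b : ℝ, 0 < b ∧ ∫⁻ ω, ENNReal.ofReal (Real.exp (b * X ω ^ 2)) ∂P < ⊤ := by
  obtain ⟨v, hv, hvc⟩ : ∃ v : NNReal, v ≠ 0 ∧ v * c < 1 :=
    ⟨(c + 1)⁻¹, by positivity, by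
      rw [inv_mul_lt_iff₀ (by positivity), mul_one]
      exact lt_add_one c⟩
  have hv0 : (0 : ℝ) < v := NNReal.coe_pos.2 (pos_iff_ne_zero.2 hv)
  refine ⟨v / 4, by positivity, ?_⟩
  have hle : ∀ ω, ENNReal.ofReal (Real.exp (v / 4 * X ω ^ 2)) ≤
      ENNReal.ofReal (Real.exp (v / 2 * m ^ 2)) *
        ENNReal.ofReal (Real.exp (v * (X ω - m) ^ 2 / 2)) := fun ω => by
    rw [← ENNReal.ofReal_mul (Real.exp_pos _).le, ← Real.exp_add]
    refine ENNReal.ofReal_le_ofReal (Real.exp_le_exp.2 ?_)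
    linarith [mul_nonneg hv0.le (sq_nonneg (X ω - 2 * m))]
  refine (lintegral_mono hle).trans_lt ?_
  rw [lintegral_const_mul' _ _ ENNReal.ofReal_ne_top]
  exact ENNReal.mul_lt_top ENNReal.ofReal_lt_top
    (lintegral_exp_mul_sq_lt_top_of_hasSubgaussianMGF h hv hvc)

end Subgaussian

theorem mainTheorem2 {Ω : Type*} [MeasurableSpace Ω] (P : Measure Ω) [IsProbabilityMeasure P]
    (X : Ω → ℝ) (hX : AEMeasurable X P)
    (h₁ : ∃ b : ℝ, 0 < b ∧ ∃ a : ℝ, 1 < a ∧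
      ∫⁻ ω, ENNReal.ofReal (Real.exp (b * |X ω| ^ a)) ∂P < ⊤)
    (h₂ : ∀ b' : ℝ, 0 < b' →
      ∫⁻ ω, ENNReal.ofReal (Real.exp (b' * X ω ^ 2)) ∂P = ⊤) :
    (∀ z : ℂ, Integrable (fun ω => Complex.exp (z * (X ω : ℂ))) P) ∧
      ∃ z : ℂ, z.re ≠ 0 ∧ ∫ ω, Complex.exp (z * (X ω : ℂ)) ∂P = 0 := by
  obtain ⟨b, hb, a, ha, hfin⟩ := h₁
  have hmeas : AEMeasurable (fun ω => Real.exp (b * |X ω| ^ a)) P := by fun_prop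
  have hrpow : Integrable (fun ω => Real.exp (b * |X ω| ^ a)) P :=
    (lintegral_ofReal_ne_top_iff_integrable hmeas.aestronglyMeasurable
      (Eventually.of_forall fun ω => (Real.exp_pos _).le)).1 hfin.ne
  have hint := integrable_exp_mul_of_rpow hX hb ha hrpow
  refine ⟨fun z => integrable_cexp_mul_of_re_mem_integrableExpSet hX (hint z.re), ?_⟩
  by_contra! hne
  obtain ⟨C, N, hC, hgrow⟩ := exists_mgf_le_exp_pow hX hb ha hrpow
  obtain ⟨c, hsub⟩ := exists_hasSubgaussianMGF_of_complexMGF_ne_zero hint hC hgrow hne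
  obtain ⟨b', hb', hlt⟩ := exists_lintegral_exp_mul_sq_lt_top hsub
  exact hlt.ne (h₂ b' hb')
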